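/- In online prize-collecting node-weighted Steiner forest, an undirected graph $G=(V,E)$ with $n=|V|$ vertices and node weights $w\in\mathbb{R}_{\ge 0}^V$ are given beforehand, as is a set $T\subseteq V\times V$ of possible terminal pairs. Requests then arrive one by one; the $i$-th request consists of a pair $(s_i,t_i)\in T$ (pairs may be repeated) and a penalty $p_i\in\mathbb{R}_{\ge 0}\cup\{+\infty\}$. The algorithm maintains a set $S\subseteq V$, initially empty. On the arrival of each request, without knowing the future ones, it must irrevocably either augment $S$ so that the induced subgraph $G[S]$ contains $s_i$ and $t_i$ and connects them, or pay $p_i$. Its cost $\mathsf{ALG}(I)$ on an input sequence $I$ is $\sum_{v\in S}w_v$ for the final set $S$ plus the sum of the paid penalties; $\mathsf{OPT}(I)$ is the minimum over all $S\subseteq V$ of $\sum_{v\in S} w_v$ plus the sum of the penalties of all requests in $I$ that are not connected in $G[S]$. Theorem. There is an absolute constant $C>0$ such that for every finite graph $G$, all node weights $w$ and every $T\subseteq V\times V$ there is a deterministic online algorithm (which may depend on $G$, $w$ and $T$) with the following properties. If $|T|\ge 2$, then for every finite online input sequence $I$ with pairs from $T$, \[ \mathsf{ALG}(I)\le C\,\log|T|\,\log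 n\cdot \mathsf{OPT}(I). \] In particular it is always $O(\log^2 n)$-competitive: if $n\ge 2$, then $\mathsf{ALG}(I)\le C\,\log^2 n\cdot \mathsf{OPT}(I)$ for every such $I$. -/

import Mathlib

open scoped NNReal ENNReal

namespace PCNWSF

/-- A request of online prize-collecting node-weighted Steiner forest: a terminal pair
`(source, target)` together with a penalty in `ℝ≥0 ∪ {∞}`. -/
structure Request (V : Type*) where
  source : V
  target : V
  penalty : ℝ≥0∞

/-- The reaction to a request: pay its penalty, or augment the bought vertex set by `X`. -/
inductive Decision (V : Type*) where
  | pay : Decision V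
  | augment (X : Finset V) : Decision V

/-- The vertices newly bought by a decision. -/
def Decision.newVertices {V : Type*} : Decision V → Finset V
  | .pay => ∅
  | .augment X => X

/-- The penalty paid by a decision in reaction to the request `r`. -/
def Decision.paidPenalty {V : Type*} (r : Request V) : Decision V → ℝ≥0∞
  | .pay => r.penalty
  | .augment _ => 0

/-- The induced subgraph `G[S]` connects `s` and `t` (in particular it contains both). -/
def Connects {V : Type*} (G : SimpleGraph V) (S : Finset V) (s t : V) : Prop :=
  ∃ (hs : s ∈ (S : Set V)) (ht : t ∈ (S : Set V)),
    (G.induce (S : Set V)).Reachable ⟨s, hs⟩ ⟨t, ht⟩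

/-- `w(S)`, the sum of the weights of the vertices in `S`. -/
noncomputable def weight {V : Type*} (w : V → ℝ≥0) (S : Finset V) : ℝ≥0∞ :=
  ∑ v ∈ S, (w v : ℝ≥0∞)

/-- All terminal pairs of the input sequence `I` belong to `T` (pairs may be repeated). -/
def DrawnFrom {V : Type*} (T : Finset (V × V)) (I : List (Request V)) : Prop :=
  ∀ r ∈ I, (r.source, r.target) ∈ T

open Classical in
/-- The offline optimum for the input sequence `I`: the least value, over all vertex sets `S`, of
`w(S)` plus the penalties of all requests that `G[S]` does not connect. -/
noncomputable def opt {V : Type*} (G : SimpleGraph V) (w : V → ℝ≥0) (I : List (Request V)) :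
    ℝ≥0∞ :=
  ⨅ S : Finset V, weight w S +
    (I.map fun r => if Connects G S r.source r.target then 0 else r.penalty).sum

/-- A deterministic online algorithm: given the requests that have arrived before and the request
that arrives now, it takes a decision.

Input sequences are stored as lists with the MOST RECENT request first, so that `r :: past` is the
sequence `past` followed in time by `r`. The algorithm's own earlier decisions
are determined by `past`. -/
def OnlineAlgorithm (V : Type*) : Type _ :=
  (past : List (Request V)) → (current : Request V) → Decision V

namespace OnlineAlgorithm

variable {V : Type*} [DecidableEq V]

/-- The vertex set bought after serving the given input sequence (most recent request first). -/
def bought (A : OnlineAlgorithm V) : List (Request V) → Finset V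
  | [] => ∅
  | r :: past => A.bought past ∪ (A past r).newVertices

/-- The sum of the penalties paid on the given input sequence (most recent request first). -/
noncomputable def penalties (A : OnlineAlgorithm V) : List (Request V) → ℝ≥0∞
  | [] => 0
  | r :: past => A.penalties past + (A past r).paidPenalty r

/-- `ALG(I)`: the weight of the bought vertices plus the paid penalties. -/
noncomputable def cost (A : OnlineAlgorithm V) (w : V → ℝ≥0) (I : List (Request V)) : ℝ≥0∞ :=
  weight w (A.bought I) + A.penalties I

/-- On every input sequence with pairs from `T`, whenever a request arrives, the algorithm pays its
penalty or immediately afterwards has bought a vertex set that connects its two terminals. -/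
def IsFeasible (A : OnlineAlgorithm V) (G : SimpleGraph V) (T : Finset (V × V)) : Prop :=
  ∀ (past : List (Request V)) (r : Request V), DrawnFrom T (r :: past) →
    A past r = Decision.pay ∨ Connects G (A.bought (r :: past)) r.source r.target

/-- `ALG(I) ≤ γ · OPT(I)` for every input sequence `I` with pairs from `T`. -/
def IsCompetitive (A : OnlineAlgorithm V) (G : SimpleGraph V) (w : V → ℝ≥0)
    (T : Finset (V × V)) (γ : ℝ) : Prop :=
  ∀ I : List (Request V), DrawnFrom T I → A.cost w I ≤ ENNReal.ofReal γ * opt G w I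

end OnlineAlgorithm

end PCNWSF

/-! The optimum is guessed by doubling, so it suffices that a phase whose budget `B` is at least the
optimum costs O(log |T| log n) times `B`. A pair that cannot be connected from scratch at cost `B`
is paid for, as any solution of cost at most `B` must do too. Otherwise the current connection cost
is either at most `B / 2 ^ L`, a cost incurred at most once per pair of `T` and hence at most `B` in
total, or it lies between `16r` and `32r` for one of `L` dyadic radii `r`.

At radius `r`, a terminal with no opened vertex of weight above `r` nearby and with less than `r` of
charge around it is charged the minimum of `r` and the penalty; this pays for the reaction to the
request. If neither terminal is of this kind, the connection is bought. It then creates a new center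
surrounded by charge at least `r`, or, because the cost exceeds `16r`, merges two classes of
facilities. Counting classes (`ScaleInv.purchases_le`) bounds these purchases by charges and opened
heavy vertices.

Heavy vertices are opened by an online set cover algorithm with exponential fractional openings and
derandomized rounding (`CoverInv.charge`), at O(a) times the charges, where `a = log (2|T|L + 1)`.

The charges act as a dual solution (`PhaseState.sum_charges_le`). Against any solution, charges to
pairs it leaves unconnected are bounded by their penalties. Charges served by one of its heavy
vertices `v` are at most `w v * (1 + log (2n))`. Every other charged terminal has solution weight
more than `r` close by (`Connects.exists_heavy_or_lt_ball`), and each vertex sees charge at most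
`2r`, so each scale contributes at most twice the weight of the solution. As `L` and `a` are O(log
|T|) and `|T| ≤ n²`, the ratio `a (log n + L)` has the claimed order. -/

namespace PCNWSF

/-! ### An online set cover engine

Elements `e : E` are charged online, vertices `v : V` of cost `w v` may be opened in order to cover
all elements that they serve. -/

section Cover

variable {V E : Type*}

/-- Some opened vertex serves `e`. -/
def Covered (serve : E → V → Prop) (F : Finset V) (e : E) : Prop := ∃ v ∈ F, serve e v

open Classical in
/-- The fractional coverage of `e`. -/
noncomputable def coverage [Fintype V] (serve : E → V → Prop) (x : V → ℝ) (e : E) : ℝ :=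
  ∑ v with serve e v, x v

open Classical in
/-- The exponential potential of the uncovered elements with capacities `u`. -/
noncomputable def coverPotential [Fintype V] [Fintype E] (serve : E → V → Prop) (a : ℝ)
    (u : E → ℝ) (x : V → ℝ)
    (F : Finset V) : ℝ :=
  ∑ e with ¬ Covered serve F e, u e * Real.exp (a * coverage serve x e)

open Classical in
/-- The total charge to the elements served by `v`. -/
noncomputable def load [Fintype E] (serve : E → V → Prop) (n : E → ℝ) (v : V) : ℝ :=
  ∑ e with serve e v, n e

/-- The fractional opening of `v` determined by the charges `n`. -/
noncomputable def opening [Fintype V] [Fintype E] (w : V → ℝ) (serve : E → V → Prop) (n : E → ℝ)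
    (v : V) : ℝ :=
  (Fintype.card V : ℝ)⁻¹ * Real.exp (load serve n v / w v)

lemma one_sub_exp_neg_le (t : ℝ) : 1 - Real.exp (-t) ≤ t := by
  have := Real.add_one_le_exp (-t)
  linarith

lemma coverage_update_of_serve [Fintype V] [DecidableEq V] {serve : E → V → Prop} {x : V → ℝ}
    {v : V} {e : E}
    (h : serve e v) (δ : ℝ) :
    coverage serve (Function.update x v (x v + δ)) e = coverage serve x e + δ := by
  classical
  unfold coverage
  have hv : v ∈ Finset.univ.filter (serve e) := by simpa using h
  rw [← Finset.add_sum_erase _ _ hv, ← Finset.add_sum_erase (Finset.univ.filter (serve e)) x hv]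
  have : ∑ z ∈ (Finset.univ.filter (serve e)).erase v, Function.update x v (x v + δ) z
      = ∑ z ∈ (Finset.univ.filter (serve e)).erase v, x z :=
    Finset.sum_congr rfl fun z hz => by
      rw [Function.update_of_ne (Finset.ne_of_mem_erase hz)]
  rw [this, Function.update_self]
  ring

lemma coverage_update_of_not_serve [Fintype V] [DecidableEq V] {serve : E → V → Prop} {x : V → ℝ}
    {v : V}
    {e : E} (h : ¬ serve e v) (y : ℝ) :
    coverage serve (Function.update x v y) e = coverage serve x e := by
  classical
  unfold coverage
  refine Finset.sum_congr rfl fun z hz => ?_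
  rw [Function.update_of_ne]
  rintro rfl
  exact h (by simpa using hz)

/-- Raising a single fractional opening: either keep `v` closed or open it. -/
lemma coverPotential_update [Fintype V] [Fintype E] [DecidableEq V] {w : V → ℝ} (hw : ∀ v, 0 ≤ w v)
    (serve : E → V → Prop) {a M : ℝ}
    (ha : 0 ≤ a) (hM : 0 ≤ M) {u : E → ℝ} (hu : ∀ e, 0 ≤ u e) (x : V → ℝ) (F : Finset V) (v : V)
    {δ : ℝ} (hδ : 0 ≤ δ) :
    coverPotential serve a u (Function.update x v (x v + δ)) F
        ≤ coverPotential serve a u x F + M * a * (δ * w v) ∨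
      coverPotential serve a u (Function.update x v (x v + δ)) (insert v F) + M * w v
        ≤ coverPotential serve a u x F + M * a * (δ * w v) := by
  classical
  set x' := Function.update x v (x v + δ) with hx'
  set P := Finset.univ.filter fun e => ¬ Covered serve F e with hP
  set f : E → ℝ := fun e => u e * Real.exp (a * coverage serve x e) with hf
  set A := ∑ e ∈ P with serve e v, f e with hA
  set R := ∑ e ∈ P with ¬ serve e v, f e with hR
  have hA0 : 0 ≤ A := Finset.sum_nonneg fun e _ => mul_nonneg (hu e) (Real.exp_nonneg _)
  have h0 : coverPotential serve a u x F = A + R := by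
    rw [hA, hR, Finset.sum_filter_add_sum_filter_not]; rfl
  have h1 : coverPotential serve a u x' F = A * Real.exp (a * δ) + R := by
    have : coverPotential serve a u x' F
        = ∑ e ∈ P with serve e v, u e * Real.exp (a * coverage serve x' e)
          + ∑ e ∈ P with ¬ serve e v, u e * Real.exp (a * coverage serve x' e) := by
      rw [Finset.sum_filter_add_sum_filter_not]; rfl
    rw [this, hA, hR, Finset.sum_mul]
    congr 1
    · refine Finset.sum_congr rfl fun e he => ?_
      rw [hx', coverage_update_of_serve (Finset.mem_filter.1 he).2, hf, mul_add, Real.exp_add]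
      ring
    · refine Finset.sum_congr rfl fun e he => ?_
      rw [hx', coverage_update_of_not_serve (Finset.mem_filter.1 he).2]
  have h2 : coverPotential serve a u x' (insert v F) = R := by
    have hset : (Finset.univ.filter fun e => ¬ Covered serve (insert v F) e)
        = P.filter fun e => ¬ serve e v := by
      ext e
      rw [Finset.mem_filter, Finset.mem_filter, hP, Finset.mem_filter]
      simp only [Covered, Finset.mem_univ, true_and, Finset.mem_insert, exists_eq_or_imp, not_or]
      exact and_comm
    unfold coverPotential
    rw [hset, hR]
    refine Finset.sum_congr rfl fun e he => ?_
    rw [hx', coverage_update_of_not_serve (Finset.mem_filter.1 he).2]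
  have haδ : 0 ≤ a * δ := mul_nonneg ha hδ
  have hMw : 0 ≤ M * w v := mul_nonneg hM (hw v)
  have hexp := one_sub_exp_neg_le (a * δ)
  have hinv : Real.exp (a * δ) * Real.exp (-(a * δ)) = 1 := by
    rw [← Real.exp_add]; simp
  have hneg := Real.exp_pos (-(a * δ))
  have hpos := Real.exp_pos (a * δ)
  rw [h0, h1, h2]
  -- Opening `v` with probability `1 - exp (-aδ)` would give the expected value `A + R + (1 - exp
  -- (-aδ)) M w v`, which meets the bound. The cheaper of the two choices therefore works, and they
  -- differ by `A exp (aδ)` against `M w v`.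
  rcases le_total (M * w v) (A * Real.exp (a * δ)) with hc | hc
  · right
    have hA1 : M * w v * Real.exp (-(a * δ)) ≤ A := by
      calc M * w v * Real.exp (-(a * δ)) ≤ A * Real.exp (a * δ) * Real.exp (-(a * δ)) :=
            mul_le_mul_of_nonneg_right hc hneg.le
        _ = A := by rw [mul_assoc, hinv, mul_one]
    have : M * w v * (1 - Real.exp (-(a * δ))) ≤ M * w v * (a * δ) :=
      mul_le_mul_of_nonneg_left hexp hMw
    linarith
  · left
    have h3 : A * Real.exp (a * δ) - A
        = A * Real.exp (a * δ) * (1 - Real.exp (-(a * δ))) := by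
      rw [mul_sub, mul_assoc, mul_assoc, hinv]; ring
    have h4 : 0 ≤ 1 - Real.exp (-(a * δ)) := by
      have : Real.exp (-(a * δ)) ≤ 1 := Real.exp_le_one_iff.2 (by linarith)
      linarith
    have h5 : A * Real.exp (a * δ) * (1 - Real.exp (-(a * δ))) ≤ M * w v * (a * δ) :=
      mul_le_mul hc hexp h4 hMw
    linarith

/-- Deterministic rounding: after the fractional openings rise from `x` to `x'`, vertices can be
opened at an average price of `a` times the fractional cost without raising the potential. -/
lemma exists_rounding [Fintype V] [Fintype E] [DecidableEq V] {w : V → ℝ} (hw : ∀ v, 0 ≤ w v)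
    (serve : E → V → Prop) {a M : ℝ}
    (ha : 0 ≤ a) (hM : 0 ≤ M) {u : E → ℝ} (hu : ∀ e, 0 ≤ u e) {x x' : V → ℝ}
    (hx : ∀ v, x v ≤ x' v) (F : Finset V) :
    ∃ O : Finset V, coverPotential serve a u x' (F ∪ O) + M * ∑ v ∈ O, w v
      ≤ coverPotential serve a u x F + M * a * ∑ v, (x' v - x v) * w v := by
  classical
  have key : ∀ U : Finset V, ∃ O : Finset V,
      coverPotential serve a u (fun v => if v ∈ U then x' v else x v) (F ∪ O) + M * ∑ v ∈ O, w v
        ≤ coverPotential serve a u x F + M * a * ∑ v ∈ U, (x' v - x v) * w v := by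
    intro U
    induction U using Finset.induction_on with
    | empty => exact ⟨∅, by simp⟩
    | insert v U hv ih =>
      obtain ⟨O, hO⟩ := ih
      set x1 : V → ℝ := fun z => if z ∈ U then x' z else x z with hx1
      have hx1v : x1 v = x v := by simp [hx1, hv]
      have hx2 : (fun z => if z ∈ insert v U then x' z else x z)
          = Function.update x1 v (x1 v + (x' v - x v)) := by
        ext z
        by_cases hz : z = v
        · subst hz; simp [hx1v]
        · simp [hx1, hz]
      rw [hx2, Finset.sum_insert hv]
      rcases coverPotential_update hw serve ha hM hu x1 (F ∪ O) v (sub_nonneg.2 (hx v)) with h | h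
      · refine ⟨O, ?_⟩
        rw [mul_add]
        linarith
      · refine ⟨insert v O, ?_⟩
        have h1 : ∑ z ∈ insert v O, w z ≤ w v + ∑ z ∈ O, w z := by
          by_cases hvO : v ∈ O
          · rw [Finset.insert_eq_of_mem hvO]; linarith [hw v]
          · rw [Finset.sum_insert hvO]
        have h2 := mul_le_mul_of_nonneg_left h1 hM
        rw [Finset.union_insert]
        rw [mul_add] at h2 ⊢
        linarith
  obtain ⟨O, hO⟩ := key Finset.univ
  exact ⟨O, by simpa using hO⟩

/-- The invariant of the set cover engine: `F` is the set of opened vertices, `q e` the total charge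
to `e` and `n e` the part of it that raised fractional openings. -/
structure CoverInv [Fintype V] [Fintype E] (w : V → ℝ) (serve : E → V → Prop) (r : E → ℝ)
    (a R : ℝ) (F : Finset V)
    (q n : E → ℝ) : Prop where
  nonneg : ∀ e, 0 ≤ n e
  le : ∀ e, n e ≤ q e
  le_cap : ∀ e, q e ≤ 2 * r e
  load_le : ∀ v, load serve n v ≤ w v * (1 + Real.log (2 * Fintype.card V))
  energy : ∑ v ∈ F, w v + ∑ e, (q e - n e) + Real.exp (-(2 * a)) *
    coverPotential serve a (fun e => 2 * r e - q e) (opening w serve n) F ≤ 4 * a * ∑ e, n e + R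

lemma CoverInv.charge_nonneg [Fintype V] [Fintype E] {w : V → ℝ} {serve : E → V → Prop} {r : E → ℝ}
    {a R : ℝ} {F : Finset V} {q n : E → ℝ} (h : CoverInv w serve r a R F q n) (e : E) : 0 ≤ q e :=
  (h.nonneg e).trans (h.le e)

/-- All openings start at `1 / |V|`, so no coverage exceeds 1 and the potential is at most `exp a`
times the total capacity. The scaling `exp (-2a)` leaves `exp (-a)`, which beats the number of
elements once `a` is its logarithm. -/
lemma coverInv_init [Fintype V] [Fintype E] {w : V → ℝ} (hw : ∀ v, 0 ≤ w v) (serve : E → V → Prop)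
    {r : E → ℝ}
    (hr : ∀ e, 0 ≤ r e) {a : ℝ} (ha : 0 ≤ a) :
    CoverInv w serve r a (Real.exp (-a) * ∑ e, 2 * r e) ∅ 0 0 := by
  classical
  refine ⟨fun e => le_rfl, fun e => le_rfl, fun e => by simpa using hr e, fun v => ?_, ?_⟩
  · have : load serve (0 : E → ℝ) v = 0 := by simp [load]
    rw [this]
    have : Nonempty V := ⟨v⟩
    have hc : (1 : ℝ) ≤ Fintype.card V := by exact_mod_cast Fintype.card_pos
    have := Real.log_nonneg (show (1 : ℝ) ≤ 2 * Fintype.card V by linarith)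
    have := hw v
    positivity
  · have hcov : ∀ e, coverage serve (opening w serve (0 : E → ℝ)) e ≤ 1 := by
      intro e
      have h1 : ∀ v, opening w serve (0 : E → ℝ) v = (Fintype.card V : ℝ)⁻¹ := by
        intro v; simp [opening, load]
      unfold coverage
      simp only [h1, Finset.sum_const, nsmul_eq_mul]
      rw [← div_eq_mul_inv]
      refine div_le_one_of_le₀ ?_ (by positivity)
      exact_mod_cast Finset.card_le_univ _
    have hpot : coverPotential serve a (fun e => 2 * r e - (0 : E → ℝ) e)
        (opening w serve (0 : E → ℝ)) ∅ ≤ Real.exp a * ∑ e, 2 * r e := by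
      unfold coverPotential
      rw [Finset.mul_sum]
      refine (Finset.sum_le_sum_of_subset_of_nonneg (Finset.filter_subset _ _) ?_).trans ?_
      · intro e _ _
        have := hr e
        simp only [Pi.zero_apply, sub_zero]
        positivity
      · refine Finset.sum_le_sum fun e _ => ?_
        have h1 : Real.exp (a * coverage serve (opening w serve (0 : E → ℝ)) e) ≤ Real.exp a :=
          Real.exp_le_exp.2 (mul_le_of_le_one_right ha (hcov e))
        have := hr e
        simp only [Pi.zero_apply, sub_zero]
        rw [mul_comm]
        exact mul_le_mul_of_nonneg_right h1 (by positivity)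
    have h2 := mul_le_mul_of_nonneg_left hpot (Real.exp_nonneg (-(2 * a)))
    have h3 : Real.exp (-(2 * a)) * (Real.exp a * ∑ e, 2 * r e)
        = Real.exp (-a) * ∑ e, 2 * r e := by
      rw [← mul_assoc, ← Real.exp_add]; ring_nf
    rw [h3] at h2
    simpa using h2

lemma load_update_of_serve [Fintype E] [DecidableEq E] {serve : E → V → Prop} {n : E → ℝ} {v : V}
    {e : E}
    (h : serve e v) (c : ℝ) :
    load serve (Function.update n e (n e + c)) v = load serve n v + c :=
  coverage_update_of_serve (serve := fun v e => serve e v) h c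

lemma load_update_of_not_serve [Fintype E] [DecidableEq E] {serve : E → V → Prop} {n : E → ℝ}
    {v : V} {e : E}
    (h : ¬ serve e v) (y : ℝ) : load serve (Function.update n e y) v = load serve n v :=
  coverage_update_of_not_serve (serve := fun v e => serve e v) h y

lemma sum_update_add {E : Type*} [Fintype E] [DecidableEq E] (q : E → ℝ) (e : E) (c : ℝ) :
    ∑ z, Function.update q e (q e + c) z = ∑ z, q z + c := by
  rw [← Finset.add_sum_erase _ _ (Finset.mem_univ e),
    ← Finset.add_sum_erase _ q (Finset.mem_univ e), Function.update_self,
    Finset.sum_congr rfl fun z hz => Function.update_of_ne (Finset.ne_of_mem_erase hz) _ q]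
  ring

lemma coverPotential_mono_cap [Fintype V] [Fintype E] {serve : E → V → Prop} {a : ℝ} {u u' : E → ℝ}
    (h : ∀ e, u' e ≤ u e) (x : V → ℝ) (F : Finset V) :
    coverPotential serve a u' x F ≤ coverPotential serve a u x F :=
  Finset.sum_le_sum fun e _ => mul_le_mul_of_nonneg_right (h e) (Real.exp_nonneg _)

/-- An uncovered element can be charged, at the price of opening further vertices. -/
lemma CoverInv.charge [Fintype V] [Fintype E] [DecidableEq V] [DecidableEq E]
    {w : V → ℝ} (hw : ∀ v, 0 ≤ w v)
    {serve : E → V → Prop} {r : E → ℝ} {a R : ℝ} (ha : 0 ≤ a)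
    (hserve : ∀ e v, serve e v → r e < w v) {F : Finset V} {q n : E → ℝ}
    (h : CoverInv w serve r a R F q n) {e : E} (he : ¬ Covered serve F e) {c : ℝ} (hc : 0 ≤ c)
    (hcr : c ≤ r e) (hq : q e + c ≤ 2 * r e) :
    ∃ (O : Finset V) (n' : E → ℝ),
      CoverInv w serve r a R (F ∪ O) (Function.update q e (q e + c)) n' := by
  classical
  set q' := Function.update q e (q e + c) with hq'
  have hqq : ∀ z, q z ≤ q' z := by
    intro z
    by_cases hz : z = e
    · subst hz; simp [hq', hc]
    · simp [hq', hz]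
  have hcap : ∀ z, q' z ≤ 2 * r z := by
    intro z
    by_cases hz : z = e
    · subst hz; simpa [hq'] using hq
    · simpa [hq', hz] using h.le_cap z
  set x := opening w serve n with hx
  have hx0 : ∀ v, 0 ≤ x v := fun v => by rw [hx]; unfold opening; positivity
  -- Below coverage 2 the charge raises the openings, and the rounding costs at most `4ac`. From
  -- coverage 2 on only `q` grows: lowering the capacity of the uncovered `e` by `c` releases at
  -- least `c exp (2a)` of potential, which pays for `c` after scaling.
  rcases lt_or_ge (coverage serve x e) 2 with hlt | hge
  · set n' := Function.update n e (n e + c) with hn'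
    set x' := opening w serve n' with hx'
    have hlevel : ∀ v, serve e v → x v < 2 := by
      intro v hv
      refine lt_of_le_of_lt ?_ hlt
      exact Finset.single_le_sum (f := x) (fun z _ => hx0 z) (by simpa using hv)
    have hwpos : ∀ v, serve e v → 0 < w v := fun v hv =>
      lt_of_le_of_lt (hc.trans hcr) (hserve e v hv)
    have hratio : ∀ v, serve e v → x' v = x v * Real.exp (c / w v) := by
      intro v hv
      simp only [hx', hx, opening, hn', load_update_of_serve hv, add_div, Real.exp_add]
      ring
    have hsame : ∀ v, ¬ serve e v → x' v = x v := by
      intro v hv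
      simp only [hx', hx, opening, hn', load_update_of_not_serve hv]
    have hmono : ∀ v, x v ≤ x' v := by
      intro v
      by_cases hv : serve e v
      · rw [hratio v hv]
        refine le_mul_of_one_le_right (hx0 v) (Real.one_le_exp ?_)
        exact div_nonneg hc (hw v)
      · rw [hsame v hv]
    have hinc : ∑ v, (x' v - x v) * w v ≤ 4 * c := by
      have h1 : ∑ v, (x' v - x v) * w v = ∑ v with serve e v, (x' v - x v) * w v := by
        refine (Finset.sum_subset (Finset.filter_subset _ _) fun v _ hv => ?_).symm
        rw [hsame v (by simpa using hv)]; ring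
      have h2 : ∀ v ∈ Finset.univ.filter (serve e), (x' v - x v) * w v ≤ 2 * c * x v := by
        intro v hv
        have hv : serve e v := by simpa using hv
        have hpos := hwpos v hv
        -- Serving vertices are heavier than `r e ≥ c`, which keeps the exponent in the range where
        -- `exp t - 1 ≤ 2t`.
        have hc1 : c / w v ≤ 1 :=
          div_le_one_of_le₀ (hcr.trans (hserve e v hv).le) (hw v)
        have hc0 : 0 ≤ c / w v := div_nonneg hc (hw v)
        have h3 := Real.abs_exp_sub_one_le (x := c / w v) (by rwa [abs_of_nonneg hc0])
        rw [abs_of_nonneg hc0] at h3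
        have h4 := (le_abs_self _).trans h3
        have h5 : (Real.exp (c / w v) - 1) * w v ≤ 2 * c := by
          calc (Real.exp (c / w v) - 1) * w v ≤ 2 * (c / w v) * w v :=
                mul_le_mul_of_nonneg_right h4 hpos.le
            _ = 2 * c := by field_simp
        rw [hratio v hv]
        calc (x v * Real.exp (c / w v) - x v) * w v
            = x v * ((Real.exp (c / w v) - 1) * w v) := by ring
          _ ≤ x v * (2 * c) := mul_le_mul_of_nonneg_left h5 (hx0 v)
          _ = 2 * c * x v := by ring
      rw [h1]
      refine (Finset.sum_le_sum h2).trans ?_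
      rw [← Finset.mul_sum]
      have : ∑ v with serve e v, x v < 2 := hlt
      nlinarith
    obtain ⟨O, hO⟩ := exists_rounding hw serve ha (Real.exp_nonneg (2 * a))
      (u := fun z => 2 * r z - q z) (fun z => sub_nonneg.2 (h.le_cap z)) hmono F
    refine ⟨O, n', ⟨?_, ?_, hcap, ?_, ?_⟩⟩
    · intro z
      by_cases hz : z = e
      · subst hz; simpa [hn'] using add_nonneg (h.nonneg z) hc
      · simpa [hn', hz] using h.nonneg z
    · intro z
      by_cases hz : z = e
      · subst hz; simpa [hn', hq'] using h.le z
      · simpa [hn', hq', hz] using h.le z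
    · intro v
      by_cases hv : serve e v
      · rw [hn', load_update_of_serve hv]
        have hpos := hwpos v hv
        have hcard : (0 : ℝ) < Fintype.card V := by
          have : Nonempty V := ⟨v⟩
          exact_mod_cast Fintype.card_pos
        -- Before this charge the opening of `v` is below 2, so its load is below `w v * log
        -- (2|V|)`; the charge overshoots by `c ≤ r e < w v`, whence the extra 1.
        have h1 : Real.exp (load serve n v / w v) < 2 * Fintype.card V := by
          have := hlevel v hv
          rw [hx] at this
          unfold opening at this
          rw [inv_mul_lt_iff₀ hcard] at this
          linarith
        have h2 : load serve n v / w v < Real.log (2 * Fintype.card V) := by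
          rwa [Real.lt_log_iff_exp_lt (by positivity)]
        rw [div_lt_iff₀ hpos] at h2
        have := hserve e v hv
        nlinarith
      · rw [hn', load_update_of_not_serve hv]
        exact h.load_le v
    · have hsum : ∑ z, (q' z - n' z) = ∑ z, (q z - n z) := by
        rw [Finset.sum_sub_distrib, Finset.sum_sub_distrib, hq', hn', sum_update_add,
          sum_update_add]
        ring
      have hF : ∑ v ∈ F ∪ O, w v ≤ ∑ v ∈ F, w v + ∑ v ∈ O, w v := by
        rw [← Finset.sum_union_inter]
        have : 0 ≤ ∑ v ∈ F ∩ O, w v := Finset.sum_nonneg fun v _ => hw v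
        linarith
      have hpot := coverPotential_mono_cap (serve := serve) (a := a)
        (u := fun z => 2 * r z - q z) (u' := fun z => 2 * r z - q' z)
        (fun z => by linarith [hqq z]) x' (F ∪ O)
      have hinv : Real.exp (-(2 * a)) * Real.exp (2 * a) = 1 := by
        rw [← Real.exp_add]; simp
      have h1 := mul_le_mul_of_nonneg_left hO (Real.exp_nonneg (-(2 * a)))
      have h2 := mul_le_mul_of_nonneg_left hpot (Real.exp_nonneg (-(2 * a)))
      rw [mul_add, mul_add, ← mul_assoc, hinv, one_mul, ← mul_assoc, ← mul_assoc, hinv,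
        one_mul] at h1
      have h3 := mul_le_mul_of_nonneg_left hinc ha
      have h4 := h.energy
      have h5 : ∑ z, n' z = ∑ z, n z + c := by rw [hn', sum_update_add]
      rw [hsum, h5]
      linarith
  · refine ⟨∅, n, ⟨h.nonneg, fun z => (h.le z).trans (hqq z), hcap, h.load_le, ?_⟩⟩
    rw [Finset.union_empty]
    have hsum : ∑ z, (q' z - n z) = ∑ z, (q z - n z) + c := by
      rw [Finset.sum_sub_distrib, Finset.sum_sub_distrib, hq', sum_update_add]
      ring
    have hmem : e ∈ Finset.univ.filter fun z => ¬ Covered serve F z := by simpa using he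
    have hpot : coverPotential serve a (fun z => 2 * r z - q' z) x F + c * Real.exp (2 * a)
        ≤ coverPotential serve a (fun z => 2 * r z - q z) x F := by
      unfold coverPotential
      rw [← Finset.add_sum_erase _ _ hmem, ← Finset.add_sum_erase (a := e) _ _ hmem]
      have h1 : ∑ z ∈ (Finset.univ.filter fun z => ¬ Covered serve F z).erase e,
          (2 * r z - q' z) * Real.exp (a * coverage serve x z)
          = ∑ z ∈ (Finset.univ.filter fun z => ¬ Covered serve F z).erase e,
          (2 * r z - q z) * Real.exp (a * coverage serve x z) :=
        Finset.sum_congr rfl fun z hz => by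
          rw [hq', Function.update_of_ne (Finset.ne_of_mem_erase hz)]
      have h2 : Real.exp (2 * a) ≤ Real.exp (a * coverage serve x e) :=
        Real.exp_le_exp.2 (by nlinarith)
      have h3 := mul_le_mul_of_nonneg_left h2 hc
      rw [h1]
      simp only [hq', Function.update_self]
      linarith
    have hinv : Real.exp (-(2 * a)) * Real.exp (2 * a) = 1 := by
      rw [← Real.exp_add]; simp
    have h1 := mul_le_mul_of_nonneg_left hpot (Real.exp_nonneg (-(2 * a)))
    rw [mul_add, mul_left_comm, hinv, mul_one] at h1
    have h2 := h.energy
    rw [hsum]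
    linarith

end Cover

/-! ### Connecting sets -/

section Joinable

variable {V : Type*} {G : SimpleGraph V} {w : V → ℝ≥0} {S S' X : Finset V} {s t u v : V}

lemma Connects.mono (h : Connects G S s t) (hS : S ⊆ S') : Connects G S' s t := by
  obtain ⟨hs, ht, hr⟩ := h
  have hle : (S : Set V) ≤ (S' : Set V) := Finset.coe_subset.2 hS
  exact ⟨hle hs, hle ht, hr.map (SimpleGraph.induceHomOfLE G hle).toHom⟩

lemma Connects.symm (h : Connects G S s t) : Connects G S t s := by
  obtain ⟨hs, ht, hr⟩ := h
  exact ⟨ht, hs, hr.symm⟩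

lemma Connects.trans (h : Connects G S s t) (h' : Connects G S t u) : Connects G S s u := by
  obtain ⟨hs, ht, hr⟩ := h
  obtain ⟨_, hu, hr'⟩ := h'
  exact ⟨hs, hu, hr.trans hr'⟩

lemma Connects.left_mem (h : Connects G S s t) : s ∈ S := h.1

lemma Connects.right_mem (h : Connects G S s t) : t ∈ S := h.symm.1

lemma Connects.refl (h : s ∈ S) : Connects G S s s :=
  ⟨h, h, SimpleGraph.Reachable.refl _⟩

lemma Connects.of_adj (hs : s ∈ S) (ht : t ∈ S) (h : G.Adj s t) : Connects G S s t :=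
  ⟨hs, ht, SimpleGraph.Adj.reachable (show (G.induce (S : Set V)).Adj ⟨s, hs⟩ ⟨t, ht⟩ from h)⟩

/-- A connection that leaves `X` uses an edge that leaves `X`. -/
lemma Connects.exists_adj_boundary (h : Connects G S s t) (hs : s ∈ X) (ht : t ∉ X) :
    ∃ u ∈ X, ∃ v ∈ S, v ∉ X ∧ G.Adj u v := by
  obtain ⟨hs', ht', ⟨p⟩⟩ := h
  obtain ⟨d, _, h1, h2⟩ := p.exists_boundary_dart {x | (x : V) ∈ X} hs ht
  exact ⟨d.fst, h1, d.snd, d.snd.2, h2, d.adj⟩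

/-- `w(X)` as a real number. -/
noncomputable def realWeight (w : V → ℝ≥0) (X : Finset V) : ℝ := ∑ v ∈ X, (w v : ℝ)

lemma realWeight_nonneg (w : V → ℝ≥0) (X : Finset V) : 0 ≤ realWeight w X :=
  Finset.sum_nonneg fun v _ => (w v).2

lemma realWeight_mono (h : S ⊆ S') : realWeight w S ≤ realWeight w S' :=
  Finset.sum_le_sum_of_subset_of_nonneg h fun v _ _ => (w v).2

variable [DecidableEq V]

lemma realWeight_union_le (w : V → ℝ≥0) (S X : Finset V) :
    realWeight w (S ∪ X) ≤ realWeight w S + realWeight w X := by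
  unfold realWeight
  rw [← Finset.sum_union_inter]
  have : 0 ≤ ∑ v ∈ S ∩ X, (w v : ℝ) := Finset.sum_nonneg fun v _ => (w v).2
  linarith

lemma realWeight_union_add_le {F : Finset V} (h : F ⊆ S) (O : Finset V) :
    realWeight w (S ∪ O) + realWeight w F ≤ realWeight w S + realWeight w (F ∪ O) := by
  have h1 : realWeight w (S ∪ O) = realWeight w S + realWeight w (O \ S) := by
    unfold realWeight
    rw [← Finset.union_sdiff_self_eq_union, Finset.sum_union Finset.disjoint_sdiff]
  have h2 : realWeight w (F ∪ O) = realWeight w F + realWeight w (O \ F) := by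
    unfold realWeight
    rw [← Finset.union_sdiff_self_eq_union, Finset.sum_union Finset.disjoint_sdiff]
  have h3 : realWeight w (O \ S) ≤ realWeight w (O \ F) :=
    realWeight_mono (Finset.sdiff_subset_sdiff subset_rfl h)
  linarith

/-- Once `S` is bought, `s` and `t` can be connected at cost at most `θ`. -/
def Joinable (G : SimpleGraph V) (w : V → ℝ≥0) (S : Finset V) (s t : V) (θ : ℝ) : Prop :=
  ∃ X : Finset V, Connects G (S ∪ X) s t ∧ realWeight w X ≤ θ

lemma Joinable.mono {θ θ' : ℝ} (h : Joinable G w S s t θ) (hS : S ⊆ S') (hθ : θ ≤ θ') :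
    Joinable G w S' s t θ' := by
  obtain ⟨X, h1, h2⟩ := h
  exact ⟨X, h1.mono (Finset.union_subset_union hS subset_rfl), h2.trans hθ⟩

lemma Joinable.symm {θ : ℝ} (h : Joinable G w S s t θ) : Joinable G w S t s θ := by
  obtain ⟨X, h1, h2⟩ := h
  exact ⟨X, h1.symm, h2⟩

lemma Joinable.trans {θ θ' : ℝ} (h : Joinable G w S s t θ) (h' : Joinable G w S t u θ') :
    Joinable G w S s u (θ + θ') := by
  obtain ⟨X, h1, h2⟩ := h
  obtain ⟨Y, h3, h4⟩ := h'
  refine ⟨X ∪ Y, (h1.mono ?_).trans (h3.mono ?_), (realWeight_union_le w X Y).trans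
    (add_le_add h2 h4)⟩
  · exact Finset.union_subset_union subset_rfl Finset.subset_union_left
  · exact Finset.union_subset_union subset_rfl Finset.subset_union_right

lemma Connects.joinable (h : Connects G S s t) : Joinable G w S s t 0 :=
  ⟨∅, by simpa using h, by simp [realWeight]⟩

/-- If `S` connects `s` to a far away vertex, then `s` has a heavy vertex of `S` nearby or the part
of `S` close to `s` has a large weight. -/
lemma Connects.exists_heavy_or_lt_ball {r : ℝ} (hr : 0 ≤ r) (h : Connects G S s t)
    (hfar : ¬ Joinable G w ∅ s t (2 * r)) :
    (∃ v ∈ S, r < w v ∧ Joinable G w {v} s v (2 * r)) ∨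
      ∃ X ⊆ S, (∀ u ∈ X, Joinable G w ∅ s u (2 * r)) ∧ r < realWeight w X := by
  classical
  by_cases hsr : r < w s
  · refine Or.inl ⟨s, h.left_mem, hsr, ∅, ?_, ?_⟩
    · simpa using Connects.refl (G := G) (Finset.mem_singleton_self s)
    · simpa [realWeight] using hr
  -- A largest connected `X ⊆ S` around `s` of weight at most `2r` misses `t`, so an edge leads from
  -- it to some `v ∈ S`. Either `v` is heavy and reached through `X`, or `w v ≤ r` and maximality
  -- forces the weight of `X` above `r`.
  set P := S.powerset.filter fun X =>
    s ∈ X ∧ (∀ u ∈ X, Connects G X s u) ∧ realWeight w X ≤ 2 * r with hP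
  have hne : P.Nonempty := by
    refine ⟨{s}, ?_⟩
    rw [hP, Finset.mem_filter, Finset.mem_powerset]
    refine ⟨by simpa using h.left_mem, by simp, ?_, ?_⟩
    · intro u hu
      rw [Finset.mem_singleton] at hu
      subst hu
      exact Connects.refl (by simp)
    · simp only [realWeight, Finset.sum_singleton]
      linarith
  obtain ⟨X, hX, hmax⟩ := Finset.exists_max_image P Finset.card hne
  rw [hP, Finset.mem_filter, Finset.mem_powerset] at hX
  obtain ⟨hXS, hsX, hXc, hXw⟩ := hX
  have hjoin : ∀ u ∈ X, Joinable G w ∅ s u (2 * r) := fun u hu =>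
    ⟨X, by simpa using hXc u hu, hXw⟩
  have htX : t ∉ X := fun ht => hfar (hjoin t ht)
  obtain ⟨u, huX, v, hvS, hvX, hadj⟩ := h.exists_adj_boundary hsX htX
  have hsv : Connects G (insert v X) s v :=
    ((hXc u huX).mono (Finset.subset_insert v X)).trans
      (Connects.of_adj (Finset.mem_insert_of_mem huX) (Finset.mem_insert_self v X) hadj)
  by_cases hv : r < w v
  · exact Or.inl ⟨v, hvS, hv, X, by simpa [Finset.singleton_union] using hsv, hXw⟩
  · refine Or.inr ⟨X, hXS, hjoin, ?_⟩
    by_contra hlt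
    have hins : insert v X ∈ P := by
      rw [hP, Finset.mem_filter, Finset.mem_powerset]
      refine ⟨Finset.insert_subset hvS hXS, Finset.mem_insert_of_mem hsX, ?_, ?_⟩
      · intro z hz
        rcases Finset.mem_insert.1 hz with rfl | hz
        · exact hsv
        · exact (hXc z hz).mono (Finset.subset_insert v X)
      · unfold realWeight at hlt ⊢
        rw [Finset.sum_insert hvX]
        linarith
    have := hmax _ hins
    rw [Finset.card_insert_of_notMem hvX] at this
    omega

/-- Either a cheap connection exists, or the connection cost lies on one of `L` dyadic scales. -/
lemma exists_scale {p : ℕ → Prop} (h0 : p 0) (L : ℕ) :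
    p L ∨ ∃ j < L, p j ∧ ¬ p (j + 1) := by
  induction L with
  | zero => exact Or.inl h0
  | succ L ih =>
    rcases ih with h | ⟨j, hj, h⟩
    · by_cases h' : p (L + 1)
      · exact Or.inl h'
      · exact Or.inr ⟨L, L.lt_succ_self, h, h'⟩
    · exact Or.inr ⟨j, hj.trans L.lt_succ_self, h⟩

end Joinable

/-! ### Sums of charges -/

section Charges

variable {E : Type*} [Fintype E] {p p' : E → Prop} {q q' : E → ℝ}

open Classical in
/-- The total charge to the elements with property `p`. -/
noncomputable def chargeOn (p : E → Prop) (q : E → ℝ) : ℝ := ∑ e with p e, q e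

lemma chargeOn_nonneg (hq : ∀ e, 0 ≤ q e) : 0 ≤ chargeOn p q :=
  Finset.sum_nonneg fun e _ => hq e

lemma chargeOn_mono (h : ∀ e, q e ≤ q' e) : chargeOn p q ≤ chargeOn p q' :=
  Finset.sum_le_sum fun e _ => h e

lemma chargeOn_mono_pred (hq : ∀ e, 0 ≤ q e) (h : ∀ e, p e → p' e) :
    chargeOn p q ≤ chargeOn p' q := by
  classical
  refine Finset.sum_le_sum_of_subset_of_nonneg (fun e he => ?_) fun e _ _ => hq e
  simp only [Finset.mem_filter, Finset.mem_univ, true_and] at he ⊢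
  exact h e he

lemma le_chargeOn (hq : ∀ e, 0 ≤ q e) {e : E} (he : p e) : q e ≤ chargeOn p q := by
  classical
  exact Finset.single_le_sum (f := q) (fun z _ => hq z) (by simpa using he)

lemma chargeOn_update_of_mem [DecidableEq E] {e : E} (he : p e) (c : ℝ) :
    chargeOn p (Function.update q e (q e + c)) = chargeOn p q + c :=
  load_update_of_serve (serve := fun e (_ : Unit) => p e) (v := ()) he c

lemma chargeOn_update_of_not_mem [DecidableEq E] {e : E} (he : ¬ p e) (y : ℝ) :
    chargeOn p (Function.update q e y) = chargeOn p q :=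
  load_update_of_not_serve (serve := fun e (_ : Unit) => p e) (v := ()) he y

lemma chargeOn_eq_sum_ite [DecidablePred p] : chargeOn p q = ∑ e, if p e then q e else 0 := by
  unfold chargeOn
  rw [Finset.sum_filter]
  congr!

lemma sum_chargeOn_fiber {ι : Type*} (g : E → ι) {P : Finset ι} (hP : ∀ e, p e → g e ∈ P) :
    ∑ i ∈ P, chargeOn (fun e => g e = i ∧ p e) q = chargeOn p q := by
  classical
  simp only [chargeOn_eq_sum_ite]
  rw [Finset.sum_comm]
  refine Finset.sum_congr rfl fun e _ => ?_
  by_cases he : p e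
  · simp [he, hP e he]
  · simp [he]

end Charges

/-! ### The state of a phase -/

section Phase

variable {V : Type*} [DecidableEq V]

/-- The elements of the set cover engine: a terminal pair, one of its two sides, and a scale. -/
abbrev Elem (T : Finset (V × V)) (L : ℕ) := ({x // x ∈ T} × Bool) × Fin L

variable {T : Finset (V × V)} {L : ℕ}

/-- The terminal of an element. -/
def Elem.terminal (e : Elem T L) : V := if e.1.2 then e.1.1.1.1 else e.1.1.1.2

/-- The radius of the `j`-th scale of a phase with budget `B`. -/
noncomputable def radius (B : ℝ) (j : ℕ) : ℝ := B / 2 ^ j / 32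

lemma radius_nonneg {B : ℝ} (hB : 0 ≤ B) (j : ℕ) : 0 ≤ radius B j := by
  unfold radius
  positivity

variable (G : SimpleGraph V) (w : V → ℝ≥0) (B : ℝ)

/-- `v` is heavy for the scale of `e` and close to its terminal. -/
def Serves (e : Elem T L) (v : V) : Prop :=
  radius B e.2 < w v ∧ Joinable G w {v} e.terminal v (2 * radius B e.2)

/-- `s` and `u` are equal or close at radius `r`. -/
def Near (r : ℝ) (s u : V) : Prop := s = u ∨ Joinable G w ∅ s u (4 * r)

/-- The total charge at scale `j` to the elements near `s`. -/
noncomputable def nearCharge (q : Elem T L → ℝ) (j : Fin L) (s : V) : ℝ :=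
  chargeOn (fun e : Elem T L => e.2 = j ∧ Near G w (radius B j) s e.terminal) q

/-- The sum of all penalties that `I` announces for the pair `x`. -/
noncomputable def pairPenalty (I : List (Request V)) (x : V × V) : ℝ≥0∞ :=
  (I.map fun r => if (r.source, r.target) = x then r.penalty else 0).sum

variable {G w B}

lemma near_self (r : ℝ) (s : V) : Near G w r s s := Or.inl rfl

/-- Two connections of cost `4r` meet at `u`. Joining from the empty set pays for the end points
too, so a terminal heavier than `4r` is near itself only by equality; regarding `f` as bought covers
that case. -/
lemma Near.joinable_of_near {r : ℝ} (hr : 0 ≤ r) {s f u : V} (h : Near G w r s u)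
    (h' : Near G w r f u) : Joinable G w {f} s f (8 * r) := by
  rcases h with rfl | h
  · rcases h' with rfl | h'
    · refine Joinable.mono (Connects.joinable (Connects.refl ?_)) subset_rfl
        (by linarith : (0 : ℝ) ≤ 8 * r)
      simp
    · exact h'.symm.mono (Finset.empty_subset _) (by linarith)
  · rcases h' with rfl | h'
    · exact h.mono (Finset.empty_subset _) (by linarith)
    · exact (h.trans h'.symm).mono (Finset.empty_subset _) (by linarith)

variable (G w B)

/-- How charges relate to the penalties announced so far, and how dense they can be. -/
structure ChargeInv (I : List (Request V)) (q : Elem T L → ℝ) : Prop where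
  far : ∀ e, 0 < q e → ¬ Joinable G w ∅ e.1.1.1.1 e.1.1.1.2 (16 * radius B e.2)
  ball : ∀ (j : Fin L) (u : V), chargeOn (fun e : Elem T L =>
    e.2 = j ∧ Joinable G w ∅ e.terminal u (2 * radius B j)) q ≤ 2 * radius B j
  paid : ∀ x : {x // x ∈ T},
    ENNReal.ofReal (chargeOn (fun e : Elem T L => e.1.1 = x) q) ≤ pairPenalty I x

open Classical in
/-- The opened vertices that are heavy at radius `r`. -/
noncomputable def heavy (r : ℝ) (F : Finset V) : Finset V := F.filter fun v => r < w v

/-- The facilities of scale `j` are the centers `C` and the heavy opened vertices; `Y` holds a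
representative of every class of connected facilities. The number of expensive purchases at this
scale is `m`. -/
structure ScaleInv (j : Fin L) (S F : Finset V) (q : Elem T L → ℝ) (C Y : Finset V) (m : ℕ) :
    Prop where
  bought : C ⊆ S
  full : ∀ f ∈ C, radius B j ≤ nearCharge G w B q j f
  disjoint : ∀ f ∈ C, ∀ f' ∈ C, f ≠ f' →
    ∀ u, Near G w (radius B j) f u → ¬ Near G w (radius B j) f' u
  link : ∀ z ∈ C ∪ heavy w (radius B j) F, ∃ y ∈ Y, Connects G S y z
  count : m + Y.card ≤ 2 * C.card + (heavy w (radius B j) F).card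

variable {G w B}

lemma nearCharge_mono {q q' : Elem T L → ℝ} (h : ∀ e, q e ≤ q' e) (j : Fin L) (s : V) :
    nearCharge G w B q j s ≤ nearCharge G w B q' j s := chargeOn_mono h

lemma mem_heavy {V : Type*} {w : V → ℝ≥0} {r : ℝ} {F : Finset V}
    {v : V} : v ∈ heavy w r F ↔ v ∈ F ∧ r < w v := by
  simp [heavy]

/-- Each newly opened heavy vertex may be a class of its own, and both sides of `count` allow for
it. -/
lemma ScaleInv.mono {j : Fin L} {S S' F F' : Finset V} {q q' : Elem T L → ℝ} {C Y : Finset V}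
    {m : ℕ} (h : ScaleInv G w B j S F q C Y m) (hS : S ⊆ S') (hF : F ⊆ F') (hFS : F' ⊆ S')
    (hq : ∀ e, q e ≤ q' e) : ∃ Y', ScaleInv G w B j S' F' q' C Y' m := by
  set H := heavy w (radius B j) F with hH
  set H' := heavy w (radius B j) F' with hH'
  have hHH : H ⊆ H' := fun v hv => by
    rw [hH', mem_heavy]
    rw [hH, mem_heavy] at hv
    exact ⟨hF hv.1, hv.2⟩
  refine ⟨Y ∪ (H' \ H), h.bought.trans hS, fun f hf => (h.full f hf).trans (nearCharge_mono hq j f),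
    h.disjoint, fun z hz => ?_, ?_⟩
  · by_cases hz' : z ∈ C ∪ H
    · obtain ⟨y, hy, hyz⟩ := h.link z hz'
      exact ⟨y, Finset.mem_union_left _ hy, hyz.mono hS⟩
    · rw [Finset.mem_union, not_or] at hz'
      have hzH : z ∈ H' := (Finset.mem_union.1 hz).resolve_left hz'.1
      refine ⟨z, Finset.mem_union_right _ (Finset.mem_sdiff.2 ⟨hzH, hz'.2⟩), Connects.refl ?_⟩
      exact hFS (mem_heavy.1 hzH).1
  · have h1 := h.count
    have h2 := Finset.card_union_le Y (H' \ H)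
    have h3 := Finset.card_sdiff_add_card_eq_card hHH
    rw [← hH] at h1
    rw [← hH']
    omega

/-- The factor 2 of `C.card` in `count` serves here: one unit for the purchase, one for the new
class. -/
lemma ScaleInv.add_center {j : Fin L} {S S' F : Finset V} {q : Elem T L → ℝ} {C Y : Finset V}
    {m : ℕ} (h : ScaleInv G w B j S F q C Y m) (hS : S ⊆ S') {s : V} (hs : s ∈ S')
    (hfull : radius B j ≤ nearCharge G w B q j s)
    (hdisj : ∀ f ∈ C, ∀ u, Near G w (radius B j) s u → ¬ Near G w (radius B j) f u) :
    ScaleInv G w B j S' F q (insert s C) (insert s Y) (m + 1) := by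
  have hsC : s ∉ C := fun hs => hdisj s hs s (near_self _ _) (near_self _ _)
  refine ⟨Finset.insert_subset hs (h.bought.trans hS), ?_, ?_, ?_, ?_⟩
  · intro f hf
    rcases Finset.mem_insert.1 hf with rfl | hf
    · exact hfull
    · exact h.full f hf
  · intro f hf f' hf' hne u hu hu'
    rcases Finset.mem_insert.1 hf with h1 | h1 <;> rcases Finset.mem_insert.1 hf' with h2 | h2
    · exact hne (h1.trans h2.symm)
    · exact hdisj f' h2 u (h1 ▸ hu) hu'
    · exact hdisj f h1 u (h2 ▸ hu') hu
    · exact h.disjoint f h1 f' h2 hne u hu hu'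
  · intro z hz
    by_cases hzs : z = s
    · subst hzs
      exact ⟨z, Finset.mem_insert_self _ _, Connects.refl hs⟩
    · rw [Finset.insert_union, Finset.mem_insert] at hz
      obtain ⟨y, hy, hyz⟩ := h.link z (hz.resolve_left hzs)
      exact ⟨y, Finset.mem_insert_of_mem hy, hyz.mono hS⟩
  · have h1 := h.count
    have h2 := Finset.card_insert_le s Y
    rw [Finset.card_insert_of_notMem hsC]
    omega

/-- The purchase is paid by the representative that disappears. -/
lemma ScaleInv.merge {j : Fin L} {S S' F : Finset V} {q : Elem T L → ℝ} {C Y : Finset V}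
    {m : ℕ} (h : ScaleInv G w B j S F q C Y m) (hS : S ⊆ S') {f f' : V}
    (hf : f ∈ C ∪ heavy w (radius B j) F) (hf' : f' ∈ C ∪ heavy w (radius B j) F)
    (hnot : ¬ Connects G S f f') (hconn : Connects G S' f f') :
    ∃ Y', ScaleInv G w B j S' F q C Y' (m + 1) := by
  obtain ⟨y, hy, hyf⟩ := h.link f hf
  obtain ⟨y', hy', hyf'⟩ := h.link f' hf'
  have hne : y ≠ y' := by
    rintro rfl
    exact hnot (hyf.symm.trans hyf')
  refine ⟨Y.erase y', h.bought.trans hS, h.full, h.disjoint, fun z hz => ?_, ?_⟩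
  · obtain ⟨x, hx, hxz⟩ := h.link z hz
    by_cases hxy : x = y'
    · subst hxy
      refine ⟨y, Finset.mem_erase.2 ⟨hne, hy⟩, ?_⟩
      exact ((hyf.mono hS).trans hconn).trans ((hyf'.symm.trans hxz).mono hS)
    · exact ⟨x, Finset.mem_erase.2 ⟨hxy, hx⟩, hxz.mono hS⟩
  · have h1 := h.count
    have h2 := Finset.card_erase_add_one hy'
    omega

/-- A terminal near a facility, or a terminal around which a new center can be created. -/
lemma ScaleInv.exists_facility {j : Fin L} {S F : Finset V} {q : Elem T L → ℝ} {C Y : Finset V}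
    {m : ℕ} (hB : 0 ≤ B) (h : ScaleInv G w B j S F q C Y m) {e : Elem T L} (he : e.2 = j)
    (hsat : Covered (Serves G w B) F e ∨ radius B j ≤ nearCharge G w B q j e.terminal) :
    (∃ f ∈ C ∪ heavy w (radius B j) F, Joinable G w {f} e.terminal f (8 * radius B j)) ∨
      (radius B j ≤ nearCharge G w B q j e.terminal ∧ ∀ f ∈ C, ∀ u,
        Near G w (radius B j) e.terminal u → ¬ Near G w (radius B j) f u) := by
  subst he
  have hr := radius_nonneg hB e.2
  rcases hsat with ⟨v, hv, hheavy, hjoin⟩ | hsat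
  · exact Or.inl ⟨v, Finset.mem_union_right _ (mem_heavy.2 ⟨hv, hheavy⟩),
      hjoin.mono subset_rfl (by linarith)⟩
  · by_cases hC : ∀ f ∈ C, ∀ u, Near G w (radius B e.2) e.terminal u → ¬ Near G w (radius B e.2) f u
    · exact Or.inr ⟨hsat, hC⟩
    · push Not at hC
      obtain ⟨f, hf, u, hu, hu'⟩ := hC
      exact Or.inl ⟨f, Finset.mem_union_left _ hf, hu.joinable_of_near hr hu'⟩

/-- If both terminals of a pair are covered or saturated, then the pair can be connected. -/
lemma ScaleInv.connect {j : Fin L} {S F : Finset V} {q : Elem T L → ℝ} {C Y : Finset V}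
    {m : ℕ} (hB : 0 ≤ B) (hFS : F ⊆ S) (h : ScaleInv G w B j S F q C Y m) {e e' : Elem T L}
    (he : e.2 = j) (he' : e'.2 = j)
    (hsat : Covered (Serves G w B) F e ∨ radius B j ≤ nearCharge G w B q j e.terminal)
    (hsat' : Covered (Serves G w B) F e' ∨ radius B j ≤ nearCharge G w B q j e'.terminal)
    (hjoin : Joinable G w S e.terminal e'.terminal (32 * radius B j))
    (hfar : ¬ Joinable G w S e.terminal e'.terminal (16 * radius B j)) :
    ∃ S' C' Y', S ⊆ S' ∧ Connects G S' e.terminal e'.terminal ∧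
      realWeight w S' ≤ realWeight w S + 48 * radius B j ∧
      ScaleInv G w B j S' F q C' Y' (m + 1) := by
  have hr := radius_nonneg hB j
  obtain ⟨X, hX, hXw⟩ := hjoin
  have hSX : S ⊆ S ∪ X := Finset.subset_union_left
  have hwX := realWeight_union_le w S X
  rcases h.exists_facility hB he hsat with ⟨f, hf, X₁, hX₁, hw₁⟩ | ⟨hfull, hdisj⟩
  · rcases h.exists_facility hB he' hsat' with ⟨f', hf', X₂, hX₂, hw₂⟩ | ⟨hfull, hdisj⟩
    · have hmem : ∀ z ∈ C ∪ heavy w (radius B j) F, z ∈ S := fun z hz =>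
        (Finset.mem_union.1 hz).elim (fun hz => h.bought hz) fun hz => hFS (mem_heavy.1 hz).1
      have hfS : {f} ⊆ S := Finset.singleton_subset_iff.2 (hmem f hf)
      have hfS' : {f'} ⊆ S := Finset.singleton_subset_iff.2 (hmem f' hf')
      -- Connected facilities would join the terminals at cost `8r + 8r`, contradicting `hfar`.
      have hnot : ¬ Connects G S f f' := fun hc => by
        have h1 : Joinable G w S e.terminal f (8 * radius B j) :=
          ⟨X₁, hX₁.mono (Finset.union_subset_union hfS subset_rfl), hw₁⟩
        have h2 : Joinable G w S e'.terminal f' (8 * radius B j) :=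
          ⟨X₂, hX₂.mono (Finset.union_subset_union hfS' subset_rfl), hw₂⟩
        exact hfar (((h1.trans hc.joinable).trans h2.symm).mono subset_rfl (by linarith))
      set S' := (S ∪ X) ∪ (X₁ ∪ X₂) with hS'
      have hSS : S ∪ X ⊆ S' := Finset.subset_union_left
      have h1 : Connects G S' e.terminal f := hX₁.mono
        (Finset.union_subset (hfS.trans (hSX.trans hSS))
          (Finset.subset_union_left.trans Finset.subset_union_right))
      have h2 : Connects G S' e'.terminal f' := hX₂.mono
        (Finset.union_subset (hfS'.trans (hSX.trans hSS))
          (Finset.subset_union_right.trans Finset.subset_union_right))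
      have h3 := hX.mono hSS
      obtain ⟨Y', hY'⟩ := h.merge (hSX.trans hSS) hf hf' hnot ((h1.symm.trans h3).trans h2)
      refine ⟨S', C, Y', hSX.trans hSS, h3, ?_, hY'⟩
      -- The cost is `32r` for `X` and `8r` for each link to a facility, `48r` in all.
      have h4 := realWeight_union_le w (S ∪ X) (X₁ ∪ X₂)
      have h5 := realWeight_union_le w X₁ X₂
      linarith
    · exact ⟨S ∪ X, _, _, hSX, hX, by linarith, h.add_center hSX hX.right_mem hfull hdisj⟩
  · exact ⟨S ∪ X, _, _, hSX, hX, by linarith, h.add_center hSX hX.left_mem hfull hdisj⟩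

/-- The centers of a scale, and hence its expensive purchases, are paid by its charges. -/
lemma ScaleInv.purchases_le {j : Fin L} {S F : Finset V} {q : Elem T L → ℝ} {C Y : Finset V}
    {m : ℕ} (hq : ∀ e, 0 ≤ q e) (hB : 0 ≤ B) (h : ScaleInv G w B j S F q C Y m) :
    radius B j * m ≤ 2 * chargeOn (fun e : Elem T L => e.2 = j) q
      + radius B j * (heavy w (radius B j) F).card := by
  classical
  have hC : (C.card : ℝ) * radius B j ≤ chargeOn (fun e : Elem T L => e.2 = j) q := by
    calc (C.card : ℝ) * radius B j = ∑ f ∈ C, radius B j := by simp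
      _ ≤ ∑ f ∈ C, nearCharge G w B q j f := Finset.sum_le_sum h.full
      _ ≤ _ := by
        unfold nearCharge chargeOn
        -- Neighbourhoods of distinct centers are disjoint, so no charge is counted twice.
        rw [← Finset.sum_biUnion]
        · refine Finset.sum_le_sum_of_subset_of_nonneg (fun e he => ?_) fun e _ _ => hq e
          simp only [Finset.mem_biUnion, Finset.mem_filter, Finset.mem_univ, true_and] at he ⊢
          obtain ⟨f, _, hf, _⟩ := he
          exact hf
        · intro f hf f' hf' hne
          rw [Function.onFun, Finset.disjoint_left]
          intro e he he'
          simp only [Finset.mem_filter, Finset.mem_univ, true_and] at he he'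
          exact h.disjoint f hf f' hf' hne _ he.2 he'.2
  have h1 : (m : ℝ) ≤ 2 * C.card + (heavy w (radius B j) F).card := by
    have := h.count
    exact_mod_cast (Nat.le_add_right m Y.card).trans this
  have h2 := mul_le_mul_of_nonneg_left h1 (radius_nonneg hB j)
  linarith

lemma chargeInv_nil (hB : 0 ≤ B) : ChargeInv G w B [] (0 : Elem T L → ℝ) := by
  have h0 : ∀ p : Elem T L → Prop, chargeOn p 0 = 0 := fun p => by simp [chargeOn]
  refine ⟨fun e he => absurd he (by simp), fun j u => ?_, fun x => by simp [h0]⟩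
  rw [h0]
  have := radius_nonneg hB j
  linarith

lemma pairPenalty_cons (r : Request V) (I : List (Request V)) (x : V × V) :
    pairPenalty (r :: I) x
      = (if (r.source, r.target) = x then r.penalty else 0) + pairPenalty I x := by
  simp [pairPenalty]

lemma ChargeInv.cons {I : List (Request V)} {q : Elem T L → ℝ} (h : ChargeInv G w B I q)
    (r : Request V) : ChargeInv G w B (r :: I) q := by
  refine ⟨h.far, h.ball, fun x => (h.paid x).trans ?_⟩
  rw [pairPenalty_cons]
  exact le_add_self

/-- Charging an element that is not saturated. -/
lemma ChargeInv.charge {I : List (Request V)} {q : Elem T L → ℝ} (h : ChargeInv G w B I q)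
    (hq : ∀ e, 0 ≤ q e) {e : Elem T L} {r : Request V}
    (hr : (r.source, r.target) = e.1.1.1)
    (hfar : ¬ Joinable G w ∅ r.source r.target (16 * radius B e.2))
    (hsat : nearCharge G w B q e.2 e.terminal < radius B e.2) {c : ℝ} (hc : 0 ≤ c)
    (hcr : c ≤ radius B e.2) (hcp : ENNReal.ofReal c ≤ r.penalty) :
    ChargeInv G w B (r :: I) (Function.update q e (q e + c)) := by
  refine ⟨?_, ?_, ?_⟩
  · intro z hz
    by_cases hze : z = e
    · subst hze
      rw [← hr]
      exact hfar
    · rw [Function.update_of_ne hze] at hz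
      exact h.far z hz
  · intro j u
    by_cases hp : e.2 = j ∧ Joinable G w ∅ e.terminal u (2 * radius B j)
    · obtain ⟨rfl, hp⟩ := hp
      rw [chargeOn_update_of_mem (p := fun z : Elem T L =>
        z.2 = e.2 ∧ Joinable G w ∅ z.terminal u (2 * radius B e.2)) ⟨rfl, hp⟩]
      -- Terminals within `2r` of `u` are within `4r` of the terminal of `e`. Together they hold
      -- less than `r` before the charge, which adds at most `r`.
      have : chargeOn (fun z : Elem T L =>
          z.2 = e.2 ∧ Joinable G w ∅ z.terminal u (2 * radius B e.2)) q
          ≤ nearCharge G w B q e.2 e.terminal := by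
        refine chargeOn_mono_pred hq fun z hz => ⟨hz.1, Or.inr ?_⟩
        exact (hp.trans hz.2.symm).mono subset_rfl (by linarith)
      linarith
    · rw [chargeOn_update_of_not_mem (p := fun z : Elem T L =>
        z.2 = j ∧ Joinable G w ∅ z.terminal u (2 * radius B j)) hp]
      exact h.ball j u
  · intro x
    rw [pairPenalty_cons]
    by_cases hx : e.1.1 = x
    · subst hx
      rw [chargeOn_update_of_mem (p := fun z : Elem T L => z.1.1 = e.1.1) rfl, if_pos hr,
        ENNReal.ofReal_add (chargeOn_nonneg hq) hc, add_comm]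
      exact add_le_add hcp (h.paid _)
    · rw [chargeOn_update_of_not_mem (p := fun z : Elem T L => z.1.1 = x) hx]
      exact (h.paid x).trans le_add_self

end Phase

/-! ### The invariant of a phase and the service of a request -/

section PhaseState

variable {V : Type*} [Fintype V] [DecidableEq V] {T : Finset (V × V)} {L : ℕ}
  (G : SimpleGraph V) (w : V → ℝ≥0) (B a : ℝ)

open Classical in
/-- The pairs of `T` that `S` connects. -/
noncomputable def connectedPairs (T : Finset (V × V)) (S : Finset V) : Finset (V × V) :=
  T.filter fun x => Connects G S x.1 x.2

/-- The invariant of a phase with budget `B`: `S` is the set of vertices chosen so far, `F` its part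
chosen by the set cover engine, `q` the charges, `n` their part that raised fractional openings,
`m` the numbers of expensive purchases and `pen` the paid penalties. -/
structure PhaseState (I : List (Request V)) (S F : Finset V) (q n : Elem T L → ℝ) (m : Fin L → ℕ)
    (pen : ℝ) : Prop where
  cover : CoverInv (fun v => (w v : ℝ)) (Serves G w B) (fun e : Elem T L => radius B e.2) a
    (Real.exp (-a) * ∑ e : Elem T L, 2 * radius B e.2) F q n
  charge : ChargeInv G w B I q
  scale : ∀ j, ∃ C Y, ScaleInv G w B j S F q C Y (m j)
  subset : F ⊆ S
  cost : realWeight w S + pen ≤ realWeight w F + 32 * ∑ e, q e + 48 * ∑ j : Fin L, radius B j * m j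
    + (connectedPairs G T S).card * (B / 2 ^ L)

variable {G w B a}

lemma phaseState_nil (hB : 0 ≤ B) (ha : 0 ≤ a) :
    PhaseState G w B a [] ∅ ∅ (0 : Elem T L → ℝ) 0 0 0 := by
  refine ⟨coverInv_init (fun v => (w v).2) _ (fun e => radius_nonneg hB _) ha, chargeInv_nil hB,
    fun j => ⟨∅, ∅, ?_⟩, subset_rfl, ?_⟩
  · exact ⟨subset_rfl, by simp, by simp, by simp [heavy], by simp⟩
  · simp only [realWeight, Finset.sum_empty, Pi.zero_apply, Finset.sum_const_zero, mul_zero,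
      Nat.cast_zero, add_zero, zero_add]
    positivity

lemma PhaseState.cons {I : List (Request V)} {S F : Finset V} {q n : Elem T L → ℝ} {m : Fin L → ℕ}
    {pen : ℝ} (h : PhaseState G w B a I S F q n m pen) (r : Request V) :
    PhaseState G w B a (r :: I) S F q n m pen :=
  ⟨h.cover, h.charge.cons r, h.scale, h.subset, h.cost⟩

lemma connectedPairs_mono {V : Type*} {G : SimpleGraph V} {T : Finset (V × V)} {S S' : Finset V}
    (h : S ⊆ S') :
    connectedPairs G T S ⊆ connectedPairs G T S' := by
  classical
  intro x hx
  simp only [connectedPairs, Finset.mem_filter] at hx ⊢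
  exact ⟨hx.1, hx.2.mono h⟩

lemma connectedPairs_card_mul_le {V : Type*} {G : SimpleGraph V} {T : Finset (V × V)}
    (hB : 0 ≤ B) {S S' : Finset V} (h : S ⊆ S') :
    (connectedPairs G T S).card * (B / 2 ^ L) ≤ (connectedPairs G T S').card * (B / 2 ^ L) := by
  refine mul_le_mul_of_nonneg_right ?_ (by positivity)
  exact_mod_cast Finset.card_le_card (connectedPairs_mono h)

/-- How a phase reacts to `r`: afterwards the pair is connected or the penalty is paid. -/
def Reaction (G : SimpleGraph V) (S' : Finset V) (r : Request V) (pen pen' : ℝ) : Prop :=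
  (pen' = pen ∧ Connects G S' r.source r.target) ∨
    (pen' = pen + r.penalty.toReal ∧ r.penalty ≠ ∞)

/-- One side of the requested pair is neither covered nor saturated. -/
lemma PhaseState.charge_step {I : List (Request V)} {S F : Finset V} {q n : Elem T L → ℝ}
    {m : Fin L → ℕ} {pen : ℝ} (hB : 0 ≤ B) (ha : 0 ≤ a)
    (h : PhaseState G w B a I S F q n m pen) {r : Request V} {e : Elem T L}
    (hr : (r.source, r.target) = e.1.1.1)
    (hjoin : Joinable G w S r.source r.target (32 * radius B e.2))
    (hfar : ¬ Joinable G w S r.source r.target (16 * radius B e.2))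
    (hcov : ¬ Covered (Serves G w B) F e)
    (hsat : nearCharge G w B q e.2 e.terminal < radius B e.2) :
    ∃ S' F' q' n' m' pen', S ⊆ S' ∧
      PhaseState (T := T) (L := L) G w B a (r :: I) S' F' q' n' m' pen' ∧
      Reaction G S' r pen pen' := by
  have hq := h.cover.charge_nonneg
  have hr0 := radius_nonneg hB e.2
  obtain ⟨X, hX, hXw⟩ := hjoin
  -- Both reactions charge some `c` to `e`; the purchase `X'` and the new penalty together cost at
  -- most `32c`.
  have key : ∀ (c pen' : ℝ) (X' : Finset V), 0 ≤ c → c ≤ radius B e.2 →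
      ENNReal.ofReal c ≤ r.penalty → realWeight w X' + pen' ≤ pen + 32 * c →
      ∃ F' q' n' m', ∃ O : Finset V, PhaseState (T := T) (L := L) G w B a (r :: I) (S ∪ O ∪ X')
        F' q' n' m' pen' := by
    intro c pen' X' hc hcr hcp hcost
    have hqe : q e ≤ nearCharge G w B q e.2 e.terminal :=
      le_chargeOn (p := fun z : Elem T L => z.2 = e.2 ∧
        Near G w (radius B e.2) e.terminal z.terminal) hq ⟨rfl, near_self _ _⟩
    obtain ⟨O, n', hcover⟩ := h.cover.charge (fun v => (w v).2) ha (fun z v hv => hv.1) hcov hc hcr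
      (by linarith)
    have hsub : S ⊆ S ∪ O ∪ X' := Finset.subset_union_left.trans Finset.subset_union_left
    have hFsub : F ∪ O ⊆ S ∪ O ∪ X' :=
      (Finset.union_subset_union h.subset subset_rfl).trans Finset.subset_union_left
    have hqq : ∀ z, q z ≤ Function.update q e (q e + c) z := by
      intro z
      by_cases hz : z = e
      · subst hz; simp [hc]
      · simp [hz]
    refine ⟨F ∪ O, Function.update q e (q e + c), n', m, O, ⟨hcover, ?_, ?_, hFsub, ?_⟩⟩
    · exact h.charge.charge hq hr
        (fun hj => hfar (hj.mono (Finset.empty_subset _) le_rfl)) hsat hc hcr hcp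
    · intro j
      obtain ⟨C, Y, hCY⟩ := h.scale j
      obtain ⟨Y', hY'⟩ := hCY.mono hsub Finset.subset_union_left hFsub hqq
      exact ⟨C, Y', hY'⟩
    · rw [sum_update_add]
      have h1 := realWeight_union_le w (S ∪ O) X'
      have h2 := realWeight_union_add_le (w := w) h.subset O
      have h3 := connectedPairs_card_mul_le (G := G) (T := T) (L := L) hB hsub
      have h4 := h.cost
      linarith
  -- The charge is the minimum of penalty and radius: a small penalty is paid, otherwise the
  -- connection of cost at most 32 radii is bought.
  by_cases hp : r.penalty ≤ ENNReal.ofReal (radius B e.2)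
  · have hfin : r.penalty ≠ ∞ := ne_top_of_le_ne_top ENNReal.ofReal_ne_top hp
    obtain ⟨F', q', n', m', O, hst⟩ := key r.penalty.toReal (pen + r.penalty.toReal) ∅
      ENNReal.toReal_nonneg (ENNReal.toReal_le_of_le_ofReal hr0 hp)
      (ENNReal.ofReal_toReal hfin).le (by
        have : (0 : ℝ) ≤ r.penalty.toReal := ENNReal.toReal_nonneg
        simp only [realWeight, Finset.sum_empty]
        linarith)
    exact ⟨_, F', q', n', m', _, Finset.subset_union_left.trans Finset.subset_union_left, hst,
      Or.inr ⟨rfl, hfin⟩⟩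
  · obtain ⟨F', q', n', m', O, hst⟩ := key (radius B e.2) pen X hr0 le_rfl (not_le.1 hp).le
      (by linarith)
    refine ⟨_, F', q', n', m', _, Finset.subset_union_left.trans Finset.subset_union_left, hst,
      Or.inl ⟨rfl, hX.mono ?_⟩⟩
    exact Finset.union_subset_union Finset.subset_union_left subset_rfl

/-- A request whose pair can be connected within the budget preserves the invariant of a phase. -/
lemma PhaseState.step {I : List (Request V)} {S F : Finset V} {q n : Elem T L → ℝ}
    {m : Fin L → ℕ} {pen : ℝ} (hB : 0 ≤ B) (ha : 0 ≤ a)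
    (h : PhaseState G w B a I S F q n m pen) {r : Request V} (hr : (r.source, r.target) ∈ T)
    (hjoin : Joinable G w ∅ r.source r.target B) :
    ∃ S' F' q' n' m' pen', S ⊆ S' ∧
      PhaseState (T := T) (L := L) G w B a (r :: I) S' F' q' n' m' pen' ∧
      Reaction G S' r pen pen' := by
  classical
  by_cases hconn : Connects G S r.source r.target
  · exact ⟨S, F, q, n, m, pen, subset_rfl, h.cons r, Or.inl ⟨rfl, hconn⟩⟩
  have h0 : Joinable G w S r.source r.target (B / 2 ^ 0) :=
    hjoin.mono (Finset.empty_subset _) (by simp)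
  rcases exists_scale (p := fun j => Joinable G w S r.source r.target (B / 2 ^ j)) h0 L with
    ⟨X, hX, hXw⟩ | ⟨j, hj, hnear, hfar⟩
  · have hsub : S ⊆ S ∪ X := Finset.subset_union_left
    refine ⟨S ∪ X, F, q, n, m, pen, hsub, ⟨h.cover, h.charge.cons r, fun i => ?_,
      h.subset.trans hsub, ?_⟩, Or.inl ⟨rfl, hX⟩⟩
    · obtain ⟨C, Y, hCY⟩ := h.scale i
      obtain ⟨Y', hY'⟩ := hCY.mono hsub subset_rfl (h.subset.trans hsub) fun _ => le_rfl
      exact ⟨C, Y', hY'⟩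
    · have hlt : (connectedPairs G T S).card < (connectedPairs G T (S ∪ X)).card := by
        refine Finset.card_lt_card ((Finset.ssubset_iff_of_subset (connectedPairs_mono hsub)).2
          ⟨(r.source, r.target), ?_, ?_⟩)
        · simpa [connectedPairs] using ⟨hr, hX⟩
        · simp [connectedPairs, hconn]
      have h1 : ((connectedPairs G T S).card : ℝ) + 1 ≤ (connectedPairs G T (S ∪ X)).card := by
        exact_mod_cast hlt
      have h2 : (0 : ℝ) ≤ B / 2 ^ L := by positivity
      have h3 := mul_le_mul_of_nonneg_right h1 h2
      have h4 := realWeight_union_le w S X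
      have h5 := h.cost
      linarith
  · set j' : Fin L := ⟨j, hj⟩ with hj'
    have h32 : (32 : ℝ) * radius B j' = B / 2 ^ j := by
      simp only [radius, hj']; ring
    have h16 : (16 : ℝ) * radius B j' = B / 2 ^ (j + 1) := by
      simp only [radius, hj', pow_succ]; field_simp; ring
    rw [← h32] at hnear
    rw [← h16] at hfar
    set e : Elem T L := ((⟨_, hr⟩, true), j') with he
    set e' : Elem T L := ((⟨_, hr⟩, false), j') with he'
    have het : e.terminal = r.source := rfl
    have het' : e'.terminal = r.target := rfl
    by_cases hs : Covered (Serves G w B) F e ∨ radius B j' ≤ nearCharge G w B q j' e.terminal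
    · by_cases hs' : Covered (Serves G w B) F e' ∨ radius B j' ≤ nearCharge G w B q j' e'.terminal
      · obtain ⟨C, Y, hCY⟩ := h.scale j'
        obtain ⟨S', C', Y', hsub, hS', hw', hCY'⟩ := hCY.connect hB h.subset rfl rfl hs hs' hnear hfar
        refine ⟨S', F, q, n, Function.update m j' (m j' + 1), pen, hsub, ⟨h.cover, h.charge.cons r,
          fun i => ?_, h.subset.trans hsub, ?_⟩, Or.inl ⟨rfl, hS'⟩⟩
        · by_cases hi : i = j'
          · subst hi
            rw [Function.update_self]
            exact ⟨C', Y', hCY'⟩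
          · rw [Function.update_of_ne hi]
            obtain ⟨C, Y, hCY⟩ := h.scale i
            obtain ⟨Y', hY'⟩ := hCY.mono hsub subset_rfl (h.subset.trans hsub) fun _ => le_rfl
            exact ⟨C, Y', hY'⟩
        · have h1 : ∑ i : Fin L, radius B i * (Function.update m j' (m j' + 1) i : ℕ)
              = ∑ i : Fin L, radius B i * m i + radius B j' := by
            rw [← sum_update_add (fun i : Fin L => radius B i * m i) j' (radius B j')]
            refine Finset.sum_congr rfl fun i _ => ?_
            by_cases hi : i = j'
            · subst hi
              simp only [Function.update_self]
              push_cast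
              ring
            · simp only [Function.update_of_ne hi]
          rw [h1]
          have h3 := connectedPairs_card_mul_le (G := G) (T := T) (L := L) hB hsub
          have h4 := h.cost
          linarith
      · rw [not_or, not_le] at hs'
        exact h.charge_step hB ha (e := e') rfl hnear hfar hs'.1 hs'.2
    · rw [not_or, not_le] at hs
      exact h.charge_step hB ha (e := e) rfl hnear hfar hs.1 hs.2

end PhaseState

/-! ### Charges as a lower bound for the optimum, and the cost of a phase -/

section Analysis

/-- A geometric tail is at most twice its largest term. The minimum with `r` carries the induction,
which halves `r`. -/
lemma sum_dyadic_below_le (x : ℝ) (hx : 0 ≤ x) (L : ℕ) (r : ℝ) (hr : 0 ≤ r) :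
    ∑ j ∈ Finset.range L, (if r / 2 ^ j < x then r / 2 ^ j else 0) ≤ 2 * min r x := by
  induction L generalizing r with
  | zero => simp [hr, hx]
  | succ L ih =>
    rw [Finset.sum_range_succ']
    have h1 : ∀ j, r / 2 ^ (j + 1) = r / 2 / 2 ^ j := fun j => by rw [pow_succ]; field_simp
    simp only [h1]
    have h2 := ih (r / 2) (by linarith)
    simp only [pow_zero, div_one]
    by_cases hrx : r < x
    · rw [if_pos hrx, min_eq_left hrx.le]
      rw [min_eq_left (by linarith)] at h2
      linarith
    · rw [if_neg hrx, min_eq_right (not_lt.1 hrx)]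
      have := min_le_right (r / 2) x
      linarith

variable {V : Type*} {T : Finset (V × V)} {L : ℕ}
  {G : SimpleGraph V} {w : V → ℝ≥0} {B a : ℝ}

/-- Over all scales, heavy facilities cost no more than twice their weight. -/
lemma sum_radius_mul_card_heavy_le (hB : 0 ≤ B) (F : Finset V) :
    ∑ j : Fin L, radius B j * (heavy w (radius B j) F).card ≤ 2 * realWeight w F := by
  have h1 : ∀ j : Fin L, radius B j * (heavy w (radius B j) F).card
      = ∑ v ∈ F, if radius B j < w v then radius B j else 0 := by
    intro j
    rw [← Finset.sum_filter, Finset.sum_const, nsmul_eq_mul, mul_comm, heavy]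
  rw [Finset.sum_congr rfl fun j _ => h1 j, Finset.sum_comm, realWeight, Finset.mul_sum]
  refine Finset.sum_le_sum fun v _ => ?_
  rw [Fin.sum_univ_eq_sum_range (fun j => if radius B j < w v then radius B j else 0) L]
  have h2 : ∀ j, radius B j = B / 32 / 2 ^ j := fun j => by unfold radius; ring
  simp only [h2]
  refine (sum_dyadic_below_le (w v) (w v).2 L (B / 32) (by positivity)).trans ?_
  exact mul_le_mul_of_nonneg_left (min_le_right _ _) (by norm_num)

open Classical in
/-- The penalties of the requests in `I` that `S` does not connect. -/
noncomputable def unconnectedPenalty (G : SimpleGraph V) (S : Finset V) (I : List (Request V)) :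
    ℝ≥0∞ :=
  (I.map fun r => if Connects G S r.source r.target then 0 else r.penalty).sum

variable [DecidableEq V]

lemma sum_pairPenalty_le {S : Finset V} (I : List (Request V)) {P : Finset (V × V)}
    (hP : ∀ x ∈ P, ¬ Connects G S x.1 x.2) :
    ∑ x ∈ P, pairPenalty I x ≤ unconnectedPenalty G S I := by
  classical
  induction I with
  | nil => simp [pairPenalty, unconnectedPenalty]
  | cons r I ih =>
    simp only [pairPenalty_cons, Finset.sum_add_distrib, Finset.sum_ite_eq]
    have : unconnectedPenalty G S (r :: I)
        = (if Connects G S r.source r.target then 0 else r.penalty) + unconnectedPenalty G S I := by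
      simp [unconnectedPenalty]
    rw [this]
    refine add_le_add ?_ ih
    by_cases hr : (r.source, r.target) ∈ P
    · rw [if_pos hr, if_neg (hP _ hr)]
    · rw [if_neg hr]
      exact zero_le

/-- The pair of an element. -/
def Elem.pair (e : Elem T L) : V × V := e.1.1.1

/-- The charges to pairs that `S` does not connect are paid by their penalties. -/
lemma ChargeInv.unconnected_le {I : List (Request V)} {q : Elem T L → ℝ}
    (h : ChargeInv G w B I q) (hq : ∀ e, 0 ≤ q e) (S : Finset V) :
    ENNReal.ofReal (chargeOn (fun e : Elem T L => ¬ Connects G S e.pair.1 e.pair.2) q)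
      ≤ unconnectedPenalty G S I := by
  classical
  set P := T.filter fun x => ¬ Connects G S x.1 x.2 with hP
  have h1 : chargeOn (fun e : Elem T L => ¬ Connects G S e.pair.1 e.pair.2) q
      ≤ ∑ x ∈ P, chargeOn (fun e : Elem T L => e.pair = x) q := by
    rw [← sum_chargeOn_fiber Elem.pair (P := P) fun e he => Finset.mem_filter.2 ⟨e.1.1.2, he⟩]
    exact Finset.sum_le_sum fun x _ => chargeOn_mono_pred hq fun e he => he.1
  refine (ENNReal.ofReal_le_ofReal h1).trans ?_
  rw [ENNReal.ofReal_sum_of_nonneg fun x _ => chargeOn_nonneg hq]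
  refine (Finset.sum_le_sum fun x hx => ?_).trans
    (sum_pairPenalty_le I fun x hx => (Finset.mem_filter.1 hx).2)
  have := h.paid ⟨x, (Finset.mem_filter.1 hx).1⟩
  simpa only [Elem.pair, Subtype.ext_iff] using this

/-- The charges to elements served by `S` are paid by the vertices of `S`. -/
lemma chargeOn_covered_le {V E : Type*} [Fintype E] {serve : E → V → Prop} {n : E → ℝ}
    (hn : ∀ e, 0 ≤ n e) (S : Finset V) :
    chargeOn (Covered serve S) n ≤ ∑ v ∈ S, load serve n v := by
  classical
  unfold load chargeOn
  simp only [Finset.sum_filter]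
  rw [Finset.sum_comm]
  refine Finset.sum_le_sum fun e _ => ?_
  have h0 : ∀ v ∈ S, 0 ≤ if serve e v then n e else 0 := fun v _ => by
    split_ifs
    exacts [hn e, le_rfl]
  by_cases he : Covered serve S e
  · rw [if_pos he]
    obtain ⟨v, hv, hev⟩ := he
    refine le_trans ?_ (Finset.single_le_sum h0 hv)
    rw [if_pos hev]
  · rw [if_neg he]
    exact Finset.sum_nonneg h0

/-- The charges to connected pairs without nearby heavy vertices of `S` are paid by the vertices of
`S` at every scale. -/
lemma ChargeInv.light_le {I : List (Request V)} {q : Elem T L → ℝ} (hB : 0 ≤ B)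
    (h : ChargeInv G w B I q) (hq : ∀ e, 0 ≤ q e) (hcap : ∀ e, q e ≤ 2 * radius B e.2)
    (S : Finset V) (j : Fin L) :
    chargeOn (fun e : Elem T L => e.2 = j ∧ Connects G S e.pair.1 e.pair.2 ∧
      ¬ Covered (Serves G w B) S e) q ≤ 2 * realWeight w S := by
  classical
  set p : Elem T L → Prop := fun e => e.2 = j ∧ Connects G S e.pair.1 e.pair.2 ∧
      ¬ Covered (Serves G w B) S e with hp
  have hw := realWeight_nonneg w S
  -- Radius 0 cannot be cancelled at the end, but then the caps leave no charge.
  rcases (radius_nonneg hB j).eq_or_lt with hr | hr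
  · have : chargeOn p q ≤ 0 := by
      rw [chargeOn_eq_sum_ite]
      refine Finset.sum_nonpos fun e _ => ?_
      split_ifs with he
      · have h1 := hcap e
        rw [he.1, ← hr] at h1
        linarith
      · exact le_rfl
    linarith
  set near : Elem T L → V → Prop := fun e u =>
    e.2 = j ∧ Joinable G w ∅ e.terminal u (2 * radius B j) with hnear
  -- A positive charge certifies that the pair is far apart, so `S` leaves the ball around the
  -- terminal and has weight above the radius in it. Exchanging the sums over elements and vertices
  -- then lets `h.ball` apply at each vertex.
  have hball : ∀ e, p e → q e * radius B j ≤ ∑ u ∈ S, if near e u then w u * q e else 0 := by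
    rintro e ⟨rfl, hconn, hcov⟩
    have hnn : ∀ u, 0 ≤ if near e u then w u * q e else 0 := fun u => by
      split_ifs
      exacts [mul_nonneg (w u).2 (hq e), le_rfl]
    rcases (hq e).eq_or_lt with h0 | h0
    · rw [← h0]
      simp
    have hfar := h.far e h0
    have hterm : ∃ t, Connects G S e.terminal t ∧
        ¬ Joinable G w ∅ e.terminal t (2 * radius B e.2) := by
      unfold Elem.terminal
      split_ifs
      · exact ⟨_, hconn, fun hj => hfar (hj.mono subset_rfl (by linarith))⟩
      · exact ⟨_, hconn.symm, fun hj => hfar (hj.symm.mono subset_rfl (by linarith))⟩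
    obtain ⟨t, ht, hjt⟩ := hterm
    rcases ht.exists_heavy_or_lt_ball hr.le hjt with ⟨v, hv, hvr, hvj⟩ | ⟨X, hXS, hX, hXw⟩
    · exact absurd ⟨v, hv, hvr, hvj⟩ hcov
    · calc q e * radius B e.2 ≤ q e * realWeight w X := mul_le_mul_of_nonneg_left hXw.le h0.le
        _ = ∑ u ∈ X, if near e u then w u * q e else 0 := by
            rw [realWeight, Finset.mul_sum]
            refine Finset.sum_congr rfl fun u hu => ?_
            rw [if_pos ⟨rfl, hX u hu⟩, mul_comm]
        _ ≤ _ := Finset.sum_le_sum_of_subset_of_nonneg hXS fun u _ _ => hnn u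
  have hsum : chargeOn p q * radius B j ≤ 2 * realWeight w S * radius B j := by
    calc chargeOn p q * radius B j ≤ ∑ e, ∑ u ∈ S, (if near e u then w u * q e else 0) := by
          rw [chargeOn_eq_sum_ite, Finset.sum_mul]
          refine Finset.sum_le_sum fun e _ => ?_
          split_ifs with he
          · exact hball e he
          · rw [zero_mul]
            refine Finset.sum_nonneg fun u _ => ?_
            split_ifs
            exacts [mul_nonneg (w u).2 (hq e), le_rfl]
      _ = ∑ u ∈ S, w u * chargeOn (fun e => near e u) q := by
          rw [Finset.sum_comm]
          refine Finset.sum_congr rfl fun u _ => ?_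
          rw [chargeOn_eq_sum_ite, Finset.mul_sum]
          exact Finset.sum_congr rfl fun e _ => (mul_ite_zero _ _ _).symm
      _ ≤ ∑ u ∈ S, w u * (2 * radius B j) :=
          Finset.sum_le_sum fun u _ => mul_le_mul_of_nonneg_left (h.ball j u) (w u).2
      _ = 2 * realWeight w S * radius B j := by
          rw [← Finset.sum_mul, realWeight]
          ring
  exact le_of_mul_le_mul_right hsum hr

variable [Fintype V]

/-- The charges that raised fractional openings are paid by any solution. -/
lemma PhaseState.sum_charges_le {I : List (Request V)} {S F : Finset V} {q n : Elem T L → ℝ}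
    {m : Fin L → ℕ} {pen : ℝ} (hB : 0 ≤ B) (h : PhaseState G w B a I S F q n m pen)
    (S' : Finset V) {β : ℝ} (hβ : 0 ≤ β) (hpen : unconnectedPenalty G S' I ≤ ENNReal.ofReal β) :
    ∑ e, n e ≤ β + realWeight w S' * (1 + Real.log (2 * Fintype.card V) + 2 * L) := by
  classical
  have hq := h.cover.charge_nonneg
  have h1 : chargeOn (fun e : Elem T L => ¬ Connects G S' e.pair.1 e.pair.2) q ≤ β :=
    (ENNReal.ofReal_le_ofReal_iff hβ).1 ((h.charge.unconnected_le hq S').trans hpen)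
  have h2 : chargeOn (Covered (Serves G w B) S') n
      ≤ realWeight w S' * (1 + Real.log (2 * Fintype.card V)) := by
    refine (chargeOn_covered_le h.cover.nonneg S').trans ?_
    rw [realWeight, Finset.sum_mul]
    exact Finset.sum_le_sum fun v _ => h.cover.load_le v
  set light : Elem T L → Prop := fun e => Connects G S' e.pair.1 e.pair.2 ∧
      ¬ Covered (Serves G w B) S' e with hlight
  have h3 : chargeOn light q ≤ 2 * L * realWeight w S' := by
    rw [← sum_chargeOn_fiber (fun e : Elem T L => e.2) (P := Finset.univ)
      fun e _ => Finset.mem_univ _]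
    refine (Finset.sum_le_sum fun j _ =>
      h.charge.light_le hB hq h.cover.le_cap S' j).trans (le_of_eq ?_)
    rw [Finset.sum_const, Finset.card_univ, Fintype.card_fin, nsmul_eq_mul]
    ring
  -- Loads bound only the part `n`, so `n` is kept on the covered elements and replaced by `q` on
  -- the others.
  have h4 : ∑ e, n e ≤ chargeOn (fun e : Elem T L => ¬ Connects G S' e.pair.1 e.pair.2) q
      + chargeOn (Covered (Serves G w B) S') n + chargeOn light q := by
    simp only [chargeOn_eq_sum_ite]
    rw [← Finset.sum_add_distrib, ← Finset.sum_add_distrib]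
    refine Finset.sum_le_sum fun e _ => ?_
    have := h.cover.le e
    have := h.cover.nonneg e
    by_cases hc : Connects G S' e.pair.1 e.pair.2 <;> by_cases hd : Covered (Serves G w B) S' e <;>
      simp [hlight, hc, hd] <;> linarith
  linarith

/-- The competitive ratio of a phase. -/
noncomputable def phaseRatio (t n L : ℕ) : ℝ :=
  128 * (4 * Real.log (2 * t * L + 1) + 1) * (1 + Real.log (2 * n) + 2 * L) + 130

/-- Charges enter with factor `32 + 2 * 48 = 128` and opened vertices with `1 + 2 * 48`; the lowest
scale adds `B`. The subtracted 1 reserves one `B` for the penalties of unaffordable pairs. -/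
lemma PhaseState.cost_le {I : List (Request V)} {S F : Finset V} {q n : Elem T L → ℝ}
    {m : Fin L → ℕ} {pen : ℝ} (hB : 0 ≤ B) (hT : T.card ≤ 2 ^ L)
    (h : PhaseState G w B (Real.log (2 * T.card * L + 1)) I S F q n m pen)
    (S' : Finset V) {β : ℝ} (hβ : 0 ≤ β) (hpen : unconnectedPenalty G S' I ≤ ENNReal.ofReal β)
    (hopt : realWeight w S' + β ≤ B) :
    realWeight w S + pen ≤ (phaseRatio T.card (Fintype.card V) L - 1) * B := by
  classical
  set a := Real.log (2 * T.card * L + 1) with ha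
  have hK : (0 : ℝ) ≤ 2 * T.card * L := by positivity
  have ha0 : 0 ≤ a := Real.log_nonneg (by linarith)
  set lam : ℝ := 1 + Real.log (2 * Fintype.card V) + 2 * L with hlam
  have hlam1 : 1 ≤ lam := by
    have h1 : 0 ≤ Real.log (2 * Fintype.card V) := by
      rw [show (2 * Fintype.card V : ℝ) = ((2 * Fintype.card V : ℕ) : ℝ) by push_cast; ring]
      exact Real.log_natCast_nonneg _
    have h2 : (0 : ℝ) ≤ L := by positivity
    linarith
  have hq := h.cover.charge_nonneg
  have hn := h.sum_charges_le hB S' hβ hpen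
  have hnlam : ∑ e, n e ≤ lam * B := by
    have h1 := mul_le_mul_of_nonneg_left hopt (zero_le_one.trans hlam1)
    have h2 := mul_le_mul_of_nonneg_right hlam1 hβ
    linarith
  -- The choice of `a` cancels the number `2|T|L` of elements.
  have hR : Real.exp (-a) * ∑ e : Elem T L, 2 * radius B e.2 ≤ B := by
    have h1 : ∑ e : Elem T L, 2 * radius B e.2 ≤ (2 * T.card * L) * B := by
      have h2 : ∀ e : Elem T L, 2 * radius B e.2 ≤ B := fun e => by
        have h3 : (1 : ℝ) ≤ 2 ^ (e.2 : ℕ) := one_le_pow₀ (by norm_num)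
        have h4 : B / 2 ^ (e.2 : ℕ) ≤ B := div_le_self hB h3
        unfold radius
        linarith
      refine (Finset.sum_le_sum fun e _ => h2 e).trans (le_of_eq ?_)
      rw [Finset.sum_const, Finset.card_univ, nsmul_eq_mul]
      simp only [Fintype.card_prod, Fintype.card_coe, Fintype.card_bool, Fintype.card_fin]
      push_cast
      ring
    have h5 : Real.exp (-a) = (2 * T.card * L + 1 : ℝ)⁻¹ := by
      rw [Real.exp_neg, ha, Real.exp_log (by linarith)]
    rw [h5, inv_mul_le_iff₀ (by linarith)]
    nlinarith
  have hpot : 0 ≤ coverPotential (Serves G w B) a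
      (fun e : Elem T L => 2 * radius B e.2 - q e)
      (opening (fun v => (w v : ℝ)) (Serves G w B) n) F :=
    Finset.sum_nonneg fun e _ =>
      mul_nonneg (sub_nonneg.2 (h.cover.le_cap e)) (Real.exp_nonneg _)
  have henergy : realWeight w F + (∑ e, q e - ∑ e, n e) ≤ 4 * a * ∑ e, n e + B := by
    have h1 := h.cover.energy
    have h2 := mul_nonneg (Real.exp_nonneg (-(2 * a))) hpot
    rw [Finset.sum_sub_distrib] at h1
    unfold realWeight
    linarith
  have hm : ∑ j : Fin L, radius B j * m j ≤ 2 * ∑ e, q e + 2 * realWeight w F := by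
    have h1 : ∑ j : Fin L, radius B j * m j ≤ ∑ j : Fin L,
        (2 * chargeOn (fun e : Elem T L => e.2 = j) q
          + radius B j * (heavy w (radius B j) F).card) :=
      Finset.sum_le_sum fun j _ => by
        obtain ⟨C, Y, hCY⟩ := h.scale j
        exact hCY.purchases_le hq hB
    have h2 : ∑ j : Fin L, chargeOn (fun e : Elem T L => e.2 = j) q = ∑ e, q e := by
      simp only [chargeOn_eq_sum_ite]
      rw [Finset.sum_comm]
      simp
    have h3 := sum_radius_mul_card_heavy_le (w := w) (L := L) hB F
    rw [Finset.sum_add_distrib, ← Finset.mul_sum, h2] at h1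
    linarith
  have hcard : (connectedPairs G T S).card * (B / 2 ^ L) ≤ B := by
    have h1 : ((connectedPairs G T S).card : ℝ) ≤ 2 ^ L := by
      exact_mod_cast (Finset.card_le_card (Finset.filter_subset _ _)).trans hT
    calc (connectedPairs G T S).card * (B / 2 ^ L) ≤ 2 ^ L * (B / 2 ^ L) :=
          mul_le_mul_of_nonneg_right h1 (by positivity)
      _ = B := by field_simp
  have hW := realWeight_nonneg w F
  have hQ : 0 ≤ ∑ e, q e := Finset.sum_nonneg fun e _ => hq e
  have h1 : realWeight w F + ∑ e, q e ≤ (4 * a + 1) * (lam * B) + B := by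
    have := mul_le_mul_of_nonneg_left hnlam (by linarith : (0 : ℝ) ≤ 4 * a + 1)
    linarith
  have h2 := h.cost
  have h3 : phaseRatio T.card (Fintype.card V) L - 1 = 128 * (4 * a + 1) * lam + 129 := by
    unfold phaseRatio
    ring
  rw [h3]
  linarith

end Analysis

/-! ### From phases to an online algorithm by doubling -/

section Algorithm

variable {V : Type*}

lemma opt_mono {G : SimpleGraph V} {w : V → ℝ≥0} {I I' : List (Request V)} (h : I.Sublist I') :
    opt G w I ≤ opt G w I' :=
  iInf_mono fun _ => add_le_add le_rfl ((h.map _).sum_le_sum fun _ _ => zero_le)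

lemma exists_eq_opt [Fintype V] (G : SimpleGraph V) (w : V → ℝ≥0) (I : List (Request V)) :
    ∃ S : Finset V, weight w S + unconnectedPenalty G S I = opt G w I :=
  exists_eq_ciInf_of_finite

lemma opt_nil (G : SimpleGraph V) (w : V → ℝ≥0) : opt G w [] = 0 := by
  refine le_antisymm ((iInf_le _ ∅).trans ?_) zero_le
  simp [weight]

lemma weight_eq_ofReal (w : V → ℝ≥0) (S : Finset V) :
    weight w S = ENNReal.ofReal (realWeight w S) := by
  unfold weight realWeight
  rw [ENNReal.ofReal_sum_of_nonneg fun v _ => NNReal.coe_nonneg (w v)]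
  simp

variable [DecidableEq V]

/-- An invariant that some decision always preserves is maintained by an online algorithm. -/
lemma exists_algorithm (G : SimpleGraph V) (T : Finset (V × V))
    {Inv : List (Request V) → Finset V → ℝ≥0∞ → Prop} (h0 : Inv [] ∅ 0)
    (hstep : ∀ I S pen r, Inv I S pen → (r.source, r.target) ∈ T → ∃ d : Decision V,
      (d = Decision.pay ∨ Connects G (S ∪ d.newVertices) r.source r.target) ∧
        Inv (r :: I) (S ∪ d.newVertices) (pen + d.paidPenalty r)) :
    ∃ A : OnlineAlgorithm V, A.IsFeasible G T ∧
      ∀ I, DrawnFrom T I → Inv I (A.bought I) (A.penalties I) := by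
  classical
  -- Paying is the default in states outside the invariant, so that the algorithm is total.
  have hchoice : ∀ (I : List (Request V)) (S : Finset V) (pen : ℝ≥0∞) (r : Request V),
      ∃ d : Decision V, Inv I S pen → (r.source, r.target) ∈ T →
        (d = Decision.pay ∨ Connects G (S ∪ d.newVertices) r.source r.target) ∧
        Inv (r :: I) (S ∪ d.newVertices) (pen + d.paidPenalty r) := by
    intro I S pen r
    by_cases h : Inv I S pen ∧ (r.source, r.target) ∈ T
    · obtain ⟨d, hd⟩ := hstep I S pen r h.1 h.2
      exact ⟨d, fun _ _ => hd⟩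
    · exact ⟨Decision.pay, fun h1 h2 => absurd ⟨h1, h2⟩ h⟩
  choose dec hdec using hchoice
  let run : List (Request V) → Finset V × ℝ≥0∞ := fun I =>
    I.rec (∅, 0) fun r I s =>
      (s.1 ∪ (dec I s.1 s.2 r).newVertices, s.2 + (dec I s.1 s.2 r).paidPenalty r)
  let A : OnlineAlgorithm V := fun I r => dec I (run I).1 (run I).2 r
  have hrun : ∀ I, run I = (A.bought I, A.penalties I) := by
    intro I
    induction I with
    | nil => rfl
    | cons r I ih =>
      change ((run I).1 ∪ (A I r).newVertices, (run I).2 + (A I r).paidPenalty r) = _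
      rw [ih]
      rfl
  have hA : ∀ I r, A I r = dec I (A.bought I) (A.penalties I) r := by
    intro I r
    change dec I (run I).1 (run I).2 r = _
    rw [hrun]
  have hInv : ∀ I, DrawnFrom T I → Inv I (A.bought I) (A.penalties I) := by
    intro I
    induction I with
    | nil => exact fun _ => h0
    | cons r I ih =>
      intro hI
      have h1 := ih fun z hz => hI z (List.mem_cons_of_mem r hz)
      have h2 := (hdec I _ _ r h1 (hI r List.mem_cons_self)).2
      rw [← hA] at h2
      exact h2
  refine ⟨A, fun I r hI => ?_, hInv⟩
  have h1 := hInv I fun z hz => hI z (List.mem_cons_of_mem r hz)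
  have h2 := (hdec I _ _ r h1 (hI r List.mem_cons_self)).1
  rw [← hA] at h2
  exact h2

lemma weight_union_le (w : V → ℝ≥0) (S X : Finset V) :
    weight w (S ∪ X) ≤ weight w S + weight w X := by
  rw [weight_eq_ofReal, weight_eq_ofReal, weight_eq_ofReal,
    ← ENNReal.ofReal_add (realWeight_nonneg w S) (realWeight_nonneg w X)]
  exact ENNReal.ofReal_le_ofReal (realWeight_union_le w S X)

open Classical in
/-- The penalties of the requests in `I` whose pairs cannot be connected within the budget. -/
noncomputable def unaffordablePenalty (G : SimpleGraph V) (w : V → ℝ≥0) (B : ℝ)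
    (I : List (Request V)) : ℝ≥0∞ :=
  (I.map fun r => if Joinable G w ∅ r.source r.target B then 0 else r.penalty).sum

lemma unaffordablePenalty_le {G : SimpleGraph V} {w : V → ℝ≥0} {B : ℝ} {S : Finset V}
    (hS : realWeight w S ≤ B) (I : List (Request V)) :
    unaffordablePenalty G w B I ≤ unconnectedPenalty G S I := by
  classical
  refine List.sum_le_sum fun r _ => ?_
  by_cases h : Connects G S r.source r.target
  · rw [if_pos ⟨S, by simpa using h, hS⟩]
    exact zero_le
  · rw [if_neg h]
    split_ifs
    exacts [zero_le, le_rfl]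

variable [Fintype V]

/-- The invariant of a phase with budget `B`. Purchases are delayed until the next augmentation. -/
def PhaseInv (G : SimpleGraph V) (w : V → ℝ≥0) (T : Finset (V × V)) (L : ℕ) (B : ℝ≥0∞)
    (I : List (Request V)) (S : Finset V) (pen : ℝ≥0∞) : Prop :=
  B = ∞ ∨ ∃ (S' F : Finset V) (q n : Elem T L → ℝ) (m : Fin L → ℕ) (p : ℝ), S ⊆ S' ∧ 0 ≤ p ∧
    pen = ENNReal.ofReal p + unaffordablePenalty G w B.toReal I ∧
    PhaseState G w B.toReal (Real.log (2 * T.card * L + 1)) I S' F q n m p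

variable {G : SimpleGraph V} {w : V → ℝ≥0} {T : Finset (V × V)} {L : ℕ} {B : ℝ≥0∞}

lemma log_mul_add_one_nonneg (t L : ℕ) : 0 ≤ Real.log (2 * t * L + 1) :=
  Real.log_nonneg (le_add_of_nonneg_left (by positivity))

lemma phaseInv_nil : PhaseInv G w T L B [] ∅ 0 :=
  Or.inr ⟨∅, ∅, 0, 0, 0, 0, subset_rfl, le_rfl, by simp [unaffordablePenalty],
    phaseState_nil ENNReal.toReal_nonneg (log_mul_add_one_nonneg _ _)⟩

/-- With an infinite budget nothing has to be bounded, and paying is always allowed. Otherwise,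
since `Decision.pay` buys nothing, `S` may lag behind the phase's set; an augmentation buys that set
in full. -/
lemma PhaseInv.step {I : List (Request V)} {S : Finset V} {pen : ℝ≥0∞}
    (h : PhaseInv G w T L B I S pen) {r : Request V} (hr : (r.source, r.target) ∈ T) :
    ∃ d : Decision V, (d = Decision.pay ∨ Connects G (S ∪ d.newVertices) r.source r.target) ∧
        PhaseInv G w T L B (r :: I) (S ∪ d.newVertices) (pen + d.paidPenalty r) := by
  classical
  rcases h with h | ⟨S', F, q, n, m, p, hS, hp, hpen, hst⟩
  · exact ⟨Decision.pay, Or.inl rfl, Or.inl h⟩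
  have hcons : unaffordablePenalty G w B.toReal (r :: I)
      = (if Joinable G w ∅ r.source r.target B.toReal then 0 else r.penalty)
        + unaffordablePenalty G w B.toReal I := by
    simp [unaffordablePenalty]
  by_cases hj : Joinable G w ∅ r.source r.target B.toReal
  · rw [if_pos hj, zero_add] at hcons
    obtain ⟨S'', F', q', n', m', p', hsub, hst', ⟨rfl, hconn⟩ | ⟨rfl, hfin⟩⟩ :=
      hst.step ENNReal.toReal_nonneg (log_mul_add_one_nonneg _ _) hr hj
    · have hSS : S ∪ S'' = S'' := Finset.union_eq_right.2 (hS.trans hsub)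
      refine ⟨Decision.augment S'', Or.inr ?_, Or.inr ⟨S'', F', q', n', m', _, ?_, hp, ?_, hst'⟩⟩
      · simpa [Decision.newVertices, hSS] using hconn
      · simp [Decision.newVertices, hSS]
      · rw [hcons, hpen]
        simp [Decision.paidPenalty]
    · refine ⟨Decision.pay, Or.inl rfl, Or.inr ⟨S'', F', q', n', m', _, ?_,
        add_nonneg hp ENNReal.toReal_nonneg, ?_, hst'⟩⟩
      · simpa [Decision.newVertices] using hS.trans hsub
      · rw [hcons, hpen, ENNReal.ofReal_add hp ENNReal.toReal_nonneg, ENNReal.ofReal_toReal hfin]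
        simp only [Decision.paidPenalty]
        ring
  · rw [if_neg hj] at hcons
    refine ⟨Decision.pay, Or.inl rfl, Or.inr ⟨S', F, q, n, m, p, ?_, hp, ?_, hst.cons r⟩⟩
    · simpa [Decision.newVertices] using hS
    · rw [hcons, hpen]
      simp only [Decision.paidPenalty]
      ring

lemma one_le_phaseRatio (t n L : ℕ) : 1 ≤ phaseRatio t n L := by
  have h1 := log_mul_add_one_nonneg t L
  have h2 : 0 ≤ Real.log (2 * n) := by
    rw [show (2 * n : ℝ) = ((2 * n : ℕ) : ℝ) by push_cast; ring]
    exact Real.log_natCast_nonneg _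
  unfold phaseRatio
  have : 0 ≤ 128 * (4 * Real.log (2 * t * L + 1) + 1) * (1 + Real.log (2 * n) + 2 * L) := by
    positivity
  linarith

/-- An optimal set weighs at most `B` and so connects no unaffordable pair. Their penalties are part
of its cost and fit into the reserved `B`. -/
lemma PhaseInv.cost_le {I : List (Request V)} {S : Finset V} {pen : ℝ≥0∞}
    (h : PhaseInv G w T L B I S pen) (hT : T.card ≤ 2 ^ L) (hopt : opt G w I ≤ B) :
    weight w S + pen ≤ ENNReal.ofReal (phaseRatio T.card (Fintype.card V) L) * B := by
  have hone := one_le_phaseRatio T.card (Fintype.card V) L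
  by_cases hB : B = ∞
  · rw [hB, ENNReal.mul_top (by simpa using zero_lt_one.trans_le hone)]
    exact le_top
  rcases h with h | ⟨S', F, q, n, m, p, hS, hp, rfl, hst⟩
  · exact absurd h hB
  obtain ⟨R, hR⟩ := exists_eq_opt G w I
  rw [← hR] at hopt
  set β := (unconnectedPenalty G R I).toReal with hβ
  have hfin : unconnectedPenalty G R I ≠ ∞ := ne_top_of_le_ne_top hB (le_add_self.trans hopt)
  have hβ' : unconnectedPenalty G R I = ENNReal.ofReal β := (ENNReal.ofReal_toReal hfin).symm
  have hβ0 : 0 ≤ β := ENNReal.toReal_nonneg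
  have hRw := realWeight_nonneg w R
  have hle : realWeight w R + β ≤ B.toReal := by
    rw [hβ', weight_eq_ofReal, ← ENNReal.ofReal_add hRw hβ0] at hopt
    exact (ENNReal.ofReal_le_iff_le_toReal hB).1 hopt
  have h1 := hst.cost_le ENNReal.toReal_nonneg hT R hβ0 hβ'.le hle
  have h2 : unaffordablePenalty G w B.toReal I ≤ ENNReal.ofReal β :=
    hβ' ▸ unaffordablePenalty_le (by linarith) I
  calc weight w S + (ENNReal.ofReal p + unaffordablePenalty G w B.toReal I)
      ≤ ENNReal.ofReal (realWeight w S') + (ENNReal.ofReal p + ENNReal.ofReal β) := by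
        rw [weight_eq_ofReal]
        exact add_le_add (ENNReal.ofReal_le_ofReal (realWeight_mono hS)) (add_le_add le_rfl h2)
    _ = ENNReal.ofReal (realWeight w S' + (p + β)) := by
        rw [ENNReal.ofReal_add (realWeight_nonneg w S') (add_nonneg hp hβ0),
          ENNReal.ofReal_add hp hβ0]
    _ ≤ ENNReal.ofReal (phaseRatio T.card (Fintype.card V) L * B.toReal) :=
        ENNReal.ofReal_le_ofReal (by linarith)
    _ = ENNReal.ofReal (phaseRatio T.card (Fintype.card V) L) * B := by
        rw [ENNReal.ofReal_mul (zero_le_one.trans hone), ENNReal.ofReal_toReal hB]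

/-- The invariant of the whole algorithm: a phase with budget `B` is running, and the earlier phases
have cost at most `γ * B`. -/
def DoublingInv (G : SimpleGraph V) (w : V → ℝ≥0) (T : Finset (V × V)) (L : ℕ) (γ : ℝ≥0∞)
    (I : List (Request V)) (S : Finset V) (pen : ℝ≥0∞) : Prop :=
  ∃ (B : ℝ≥0∞) (P S' : Finset V) (p pen' : ℝ≥0∞) (I' : List (Request V)),
    S = P ∪ S' ∧ pen = p + pen' ∧ I'.Sublist I ∧ opt G w I ≤ B ∧ B ≤ 2 * opt G w I ∧
    weight w P + p ≤ γ * B ∧ PhaseInv G w T L B I' S' pen'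

lemma doublingInv_nil {γ : ℝ≥0∞} : DoublingInv G w T L γ [] ∅ 0 :=
  ⟨0, ∅, ∅, 0, 0, [], by simp, by simp, List.Sublist.refl _, by simp [opt_nil], by simp,
    by simp [weight], phaseInv_nil⟩

lemma DoublingInv.cost_le {γ : ℝ≥0∞}
    (hγ : ∀ B I S pen, PhaseInv G w T L B I S pen → opt G w I ≤ B → weight w S + pen ≤ γ * B)
    {I : List (Request V)} {S : Finset V} {pen : ℝ≥0∞} (h : DoublingInv G w T L γ I S pen) :
    weight w S + pen ≤ 4 * γ * opt G w I := by
  obtain ⟨B, P, S', p, pen', I', rfl, rfl, hsub, hle, hB, hP, hph⟩ := h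
  calc weight w (P ∪ S') + (p + pen') ≤ weight w P + weight w S' + (p + pen') :=
        add_le_add (weight_union_le w P S') le_rfl
    _ = (weight w P + p) + (weight w S' + pen') := by ring
    _ ≤ γ * B + γ * B := add_le_add hP (hγ _ _ _ _ hph ((opt_mono hsub).trans hle))
    _ ≤ γ * (2 * opt G w I) + γ * (2 * opt G w I) := by gcongr
    _ = 4 * γ * opt G w I := by ring

/-- Once the optimum exceeds the budget `B`, a new phase starts from nothing with twice the optimum
as budget. All earlier cost is at most `2γB`, hence at most `γ` times the new budget. -/
lemma DoublingInv.step {γ : ℝ≥0∞}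
    (hγ : ∀ B I S pen, PhaseInv G w T L B I S pen → opt G w I ≤ B → weight w S + pen ≤ γ * B)
    {I : List (Request V)} {S : Finset V} {pen : ℝ≥0∞} (h : DoublingInv G w T L γ I S pen)
    {r : Request V} (hr : (r.source, r.target) ∈ T) :
    ∃ d : Decision V, (d = Decision.pay ∨ Connects G (S ∪ d.newVertices) r.source r.target) ∧
        DoublingInv G w T L γ (r :: I) (S ∪ d.newVertices) (pen + d.paidPenalty r) := by
  obtain ⟨B, P, S', p, pen', I', rfl, rfl, hsub, hle, hB, hP, hph⟩ := h
  have hmono : opt G w I ≤ opt G w (r :: I) := opt_mono (List.sublist_cons_self r I)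
  by_cases hopt : opt G w (r :: I) ≤ B
  · obtain ⟨d, hd, hph'⟩ := hph.step hr
    refine ⟨d, hd.imp_right fun hd => hd.mono ?_, B, P, S' ∪ d.newVertices, p,
      pen' + d.paidPenalty r, r :: I', ?_, ?_, hsub.cons_cons r, hopt, ?_, hP, hph'⟩
    · exact Finset.union_subset_union Finset.subset_union_right subset_rfl
    · rw [Finset.union_assoc]
    · rw [add_assoc]
    · exact hB.trans (by gcongr)
  · obtain ⟨d, hd, hph'⟩ := (phaseInv_nil (G := G) (w := w) (T := T) (L := L)
      (B := 2 * opt G w (r :: I))).step hr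
    refine ⟨d, hd.imp_right fun hd => hd.mono ?_, 2 * opt G w (r :: I), P ∪ S',
      ∅ ∪ d.newVertices, p + pen', 0 + d.paidPenalty r, [r], ?_, ?_, ?_, ?_, le_rfl, ?_, hph'⟩
    · exact Finset.union_subset_union (Finset.empty_subset _) subset_rfl
    · rw [Finset.empty_union]
    · rw [zero_add]
    · exact List.singleton_sublist.2 List.mem_cons_self
    · exact le_mul_of_one_le_left zero_le one_le_two
    · have hlt := (not_le.1 hopt).le
      calc weight w (P ∪ S') + (p + pen') ≤ weight w P + weight w S' + (p + pen') :=
            add_le_add (weight_union_le w P S') le_rfl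
        _ = (weight w P + p) + (weight w S' + pen') := by ring
        _ ≤ γ * B + γ * B := add_le_add hP (hγ _ _ _ _ hph ((opt_mono hsub).trans hle))
        _ ≤ γ * opt G w (r :: I) + γ * opt G w (r :: I) := by gcongr
        _ = γ * (2 * opt G w (r :: I)) := by ring

/-- There is a feasible algorithm whose competitive ratio is four times the ratio of a phase. -/
lemma exists_competitive (G : SimpleGraph V) (w : V → ℝ≥0) (T : Finset (V × V)) {L : ℕ}
    (hT : T.card ≤ 2 ^ L) : ∃ A : OnlineAlgorithm V, A.IsFeasible G T ∧
      A.IsCompetitive G w T (4 * phaseRatio T.card (Fintype.card V) L) := by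
  set γ := ENNReal.ofReal (phaseRatio T.card (Fintype.card V) L) with hγ
  have hph : ∀ B I S pen, PhaseInv G w T L B I S pen → opt G w I ≤ B →
      weight w S + pen ≤ γ * B := fun B I S pen h hle => h.cost_le hT hle
  obtain ⟨A, hfeas, hinv⟩ := exists_algorithm G T (Inv := DoublingInv G w T L γ) doublingInv_nil
    fun I S pen r h hr => h.step hph hr
  refine ⟨A, hfeas, fun I hI => ?_⟩
  rw [ENNReal.ofReal_mul (by norm_num), ← hγ, ENNReal.ofReal_ofNat]
  exact (hinv I hI).cost_le hph

end Algorithm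

/-! ### Numerical estimates of the ratio -/

lemma OnlineAlgorithm.IsCompetitive.mono {V : Type*} [DecidableEq V] {A : OnlineAlgorithm V}
    {G : SimpleGraph V} {w : V → ℝ≥0} {T : Finset (V × V)} {γ γ' : ℝ}
    (h : A.IsCompetitive G w T γ) (hγ : γ ≤ γ') : A.IsCompetitive G w T γ' :=
  fun I hI => (h I hI).trans (by gcongr)

/-- Both `L` and `log (2tL + 1)` are O(log t), and `t ≤ n²` turns the `L` of the last factor into
O(log n). Additive constants are absorbed since both logarithms are at least `log 2`. -/
lemma phaseRatio_clog_le {t n : ℕ} (ht : 2 ≤ t) (htn : t ≤ n ^ 2) :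
    phaseRatio t n (Nat.clog 2 t) ≤ 40000 * (Real.log t * Real.log n) := by
  have hn : 2 ≤ n := by
    by_contra h
    have : n ≤ 1 := by omega
    have := Nat.pow_le_pow_left this 2
    omega
  set L := Nat.clog 2 t with hL
  have ht' : (2 : ℝ) ≤ t := by exact_mod_cast ht
  have hn' : (2 : ℝ) ≤ n := by exact_mod_cast hn
  have hlog2 := Real.log_two_gt_d9
  have hlog2' := Real.log_two_lt_d9
  have hlt : Real.log 2 ≤ Real.log t := Real.log_le_log (by norm_num) ht'
  have hln : Real.log 2 ≤ Real.log n := Real.log_le_log (by norm_num) hn'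
  have htn' : Real.log t ≤ 2 * Real.log n := by
    have h1 : (t : ℝ) ≤ (n : ℝ) ^ 2 := by exact_mod_cast htn
    have h2 := Real.log_le_log (by linarith) h1
    rw [Real.log_pow] at h2
    exact_mod_cast h2
  have hLt : (L : ℝ) ≤ 3 * Real.log t := by
    have h1 : 2 ^ L.pred < t := Nat.pow_pred_clog_lt_self (by norm_num) (by omega)
    have hLpos : 0 < L := Nat.clog_pos (by norm_num) ht
    have h2 : (2 : ℝ) ^ L.pred ≤ t := by exact_mod_cast h1.le
    have h3 := Real.log_le_log (by positivity) h2
    rw [Real.log_pow] at h3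
    have h4 : ((L.pred : ℕ) : ℝ) = L - 1 := by
      rw [Nat.pred_eq_sub_one, Nat.cast_sub hLpos, Nat.cast_one]
    rw [h4] at h3
    nlinarith
  have hLt' : L ≤ t := Nat.clog_le_of_le_pow (Nat.lt_two_pow_self).le
  have ha : Real.log (2 * t * L + 1) ≤ 4 * Real.log t := by
    have h1 : (L : ℝ) ≤ t := by exact_mod_cast hLt'
    have h2 : (2 * t * L + 1 : ℝ) ≤ (t : ℝ) ^ 4 := by
      have h3 : (4 : ℝ) ≤ (t : ℝ) ^ 2 := by nlinarith
      have h4 : (t : ℝ) * L ≤ (t : ℝ) ^ 2 := by nlinarith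
      nlinarith
    have h3 := Real.log_le_log (by positivity) h2
    rw [Real.log_pow] at h3
    exact_mod_cast h3
  have hlog2n : Real.log (2 * n) = Real.log 2 + Real.log n :=
    Real.log_mul (by norm_num) (by linarith)
  have h1 : 4 * Real.log (2 * t * L + 1) + 1 ≤ 18 * Real.log t := by linarith
  have h2 : 1 + Real.log (2 * n) + 2 * L ≤ 16 * Real.log n := by
    rw [hlog2n]
    linarith
  have h3 : 0 ≤ 1 + Real.log (2 * n) + 2 * (L : ℝ) := by
    rw [hlog2n]
    positivity
  have h4 := mul_le_mul h1 h2 h3 (by linarith)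
  have h5 : 0.4 ≤ Real.log t * Real.log n := by nlinarith
  unfold phaseRatio
  nlinarith

/-- This serves the case of at most one pair: there are no scales and a single logarithm remains. -/
lemma phaseRatio_zero_le {t n : ℕ} (hn : 2 ≤ n) :
    phaseRatio t n 0 ≤ 80000 * Real.log n ^ 2 := by
  have hn' : (2 : ℝ) ≤ n := by exact_mod_cast hn
  have hlog2 := Real.log_two_gt_d9
  have hlog2' := Real.log_two_lt_d9
  have hln : Real.log 2 ≤ Real.log n := Real.log_le_log (by norm_num) hn'
  have hlog2n : Real.log (2 * n) = Real.log 2 + Real.log n :=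
    Real.log_mul (by norm_num) (by linarith)
  simp only [phaseRatio, Nat.cast_zero, mul_zero, zero_add, Real.log_one, add_zero, mul_one, hlog2n]
  nlinarith

end PCNWSF

theorem theorem2 :
    ∃ C : ℝ, 0 < C ∧
      ∀ (V : Type*) [Fintype V] [DecidableEq V] (G : SimpleGraph V) (w : V → NNReal)
        (T : Finset (V × V)),
        ∃ A : PCNWSF.OnlineAlgorithm V,
          A.IsFeasible G T ∧
          (2 ≤ T.card →
            A.IsCompetitive G w T (C * Real.log T.card * Real.log (Fintype.card V))) ∧
          (2 ≤ Fintype.card V →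
            A.IsCompetitive G w T (C * Real.log (Fintype.card V) ^ 2)) := by
  -- This is `4 * 40000 * 2`, from doubling, the ratio of a phase and `log |T| ≤ 2 log n`; it also
  -- equals `4 * 80000`, for at most one pair.
  refine ⟨320000, by norm_num, fun V _ _ G w T => ?_⟩
  obtain ⟨A, hfeas, hcomp⟩ := PCNWSF.exists_competitive G w T
    (Nat.le_pow_clog (b := 2) (by norm_num) T.card)
  have hcard : T.card ≤ Fintype.card V ^ 2 := by
    have := Finset.card_le_univ T
    rwa [Fintype.card_prod, ← sq] at this
  refine ⟨A, hfeas, fun hT => hcomp.mono ?_, fun hn => hcomp.mono ?_⟩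
  · have h1 := PCNWSF.phaseRatio_clog_le hT hcard
    have h2 : 0 ≤ Real.log T.card * Real.log (Fintype.card V) :=
      mul_nonneg (Real.log_natCast_nonneg _) (Real.log_natCast_nonneg _)
    linarith
  · rcases lt_or_ge T.card 2 with hT | hT
    · rw [Nat.clog_of_right_le_one (by omega)]
      have := PCNWSF.phaseRatio_zero_le (t := T.card) hn
      linarith
    · have h1 := PCNWSF.phaseRatio_clog_le hT hcard
      have h2 : Real.log T.card ≤ 2 * Real.log (Fintype.card V) := by
        have h3 : (T.card : ℝ) ≤ (Fintype.card V : ℝ) ^ 2 := by exact_mod_cast hcard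
        have h4 := Real.log_le_log (by exact_mod_cast (by omega : 0 < T.card)) h3
        rw [Real.log_pow] at h4
        exact_mod_cast h4
      have h5 := mul_le_mul_of_nonneg_right h2 (Real.log_natCast_nonneg (Fintype.card V))
      nlinarith
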